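/- Let $\mathbb T=\mathbb R/\mathbb Z$ (points identified with their representatives in $[0,1)$), $a\in(0,1)$, and let $T:\mathbb T^2\to\mathbb T^2$ be the generalized baker map $T(\xi,x)=(\tau(\xi),ax)$ if $\xi\in[0,a)$ and $T(\xi,x)=(\tau(\xi),a+(1-a)x)$ if $\xi\in[a,1)$, where $\tau(\xi)=a^{-1}\xi$ on $[0,a)$ and $\tau(\xi)=(1-a)^{-1}(\xi-a)$ on $[a,1)$ (so $\tau'=a^{-1}$, resp. $(1-a)^{-1}$, there). Let $f(\xi,x,y)=(T(\xi,x),f_x(y))$ on $\mathbb T^2\times\mathbb R$, where the fibre maps $f_x:\mathbb R\to\mathbb R$ $(x\in\mathbb T)$ are uniformly bounded $C^3$ maps with $f_x'>0$ and negative Schwarzian derivative $\frac{f_x'''}{f_x'}-\frac32\big(\frac{f_x''}{f_x'}\big)^2<0$, and $x\mapsto f_x$ is continuous on $\mathbb T$ (locally uniformly in $y$). Assume that there are compact intervals $I\subseteq J^\circ$, $J\subseteq\mathbb R$, such that $f_x(J)\subseteq I^\circ$ for all $x$, $\inf_{(x,y)\in\mathbb T\times J}\tau'(x)\,f'_{\tau(x)}(y)>1$,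 and $(x,y)\mapsto f_x(y)$ is of class $C^2$ on $\mathbb T\times J$. Let $\varphi^-\le\varphi^+$ be the lower and upper bounding functions of the global attractor $\bigcap_{n\ge0}f^n(\mathbb T^2\times\mathbb R)=\{(\theta,y):\varphi^-(\theta)\le y\le\varphi^+(\theta)\}$, and assume that $\varphi^\pm$ take values in $I$. Let $P=\{\theta\in\mathbb T^2:\varphi^+(\theta)=\varphi^-(\theta)\}$, let $C^\pm$ be the set of continuity points of $\varphi^\pm$, let $\mathcal P$ be the closure in $\mathbb T^2\times\mathbb R$ of the graph of $\varphi^+|_P=\varphi^-|_P$, and let $m^2$ be Lebesgue measure on $\mathbb T^2$. Assume case B: $P=C^+\cap C^-$, and this is a dense $G_\delta$-subset of $\mathbb T^2$. Call a function on $\mathbb T^2$ of class $C^{1+\mathrm{Lip}}$ if it is continuously differentiable with Lipschitz continuous derivative. Then: a) If $m^2(P)=0$, then $\mathcal P$ is the graph of a $C^{1+\mathrm{Lip}}$ function over $\mathbb T^2$ that depends only on the stable coordinate $x$. b) If $\varphi^+$ is continuous, then its graph equals $\mathcal P$, and case B1 is excluded, i.e. there is no $\theta\in\mathbb T^2$ with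 $\#\{y\in I:(\theta,y)\in\mathcal P\}>1$. If moreover $m^2(P)=0$, then $\varphi^+$ is of class $C^{1+\mathrm{Lip}}$. The same holds with $\varphi^-$ in place of $\varphi^+$. -/

import Mathlib

namespace BakerSkew

noncomputable section

/-- The one-dimensional torus `ℝ / ℤ`. -/
abbrev Torus : Type := UnitAddCircle

/-- The two-dimensional torus, with points written `θ = (ξ, x)`. -/
abbrev Torus2 : Type := Torus × Torus

/-- The representative in `[0, 1)` of a point of the torus. -/
def rep (x : Torus) : ℝ := (AddCircle.equivIco (1 : ℝ) 0 x : ℝ)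

/-- The expanding piecewise affine circle map `τ` with branches on `[0, a)` and `[a, 1)`. -/
def tau (a : ℝ) (x : Torus) : Torus :=
  if rep x < a then ((a⁻¹ * rep x : ℝ) : Torus)
  else (((1 - a)⁻¹ * (rep x - a) : ℝ) : Torus)

/-- The slope `τ'` of `τ` on its two branches. -/
def tauSlope (a : ℝ) (x : Torus) : ℝ := if rep x < a then a⁻¹ else (1 - a)⁻¹

/-- The generalized baker map `T` with discontinuity at `a`. -/
def baker (a : ℝ) (θ : Torus2) : Torus2 :=
  (tau a θ.1,
    if rep θ.1 < a then ((a * rep θ.2 : ℝ) : Torus)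
    else ((a + (1 - a) * rep θ.2 : ℝ) : Torus))

/-- The skew product `(ξ, x, y) ↦ (T (ξ, x), f_x(y))`; the fibre maps depend on `x` only. -/
def skew (a : ℝ) (f : Torus → ℝ → ℝ) (p : Torus2 × ℝ) : Torus2 × ℝ :=
  (baker a p.1, f p.1.2 p.2)

/-- The Schwarzian derivative `g''' / g' - (3/2) (g'' / g')²`. -/
def schwarzian (g : ℝ → ℝ) (y : ℝ) : ℝ :=
  iteratedDeriv 3 g y / deriv g y - 3 / 2 * (iteratedDeriv 2 g y / deriv g y) ^ 2

/-- The global attractor `⋂ₙ fⁿ(𝕋² × ℝ)`. -/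
def globalAttractor (a : ℝ) (f : Torus → ℝ → ℝ) : Set (Torus2 × ℝ) :=
  ⋂ n : ℕ, (skew a f)^[n] '' Set.univ

/-- The upper bounding graph `φ⁺` of the global attractor. -/
def phiPlus (a : ℝ) (f : Torus → ℝ → ℝ) (θ : Torus2) : ℝ :=
  sSup {y : ℝ | (θ, y) ∈ globalAttractor a f}

/-- The lower bounding graph `φ⁻` of the global attractor. -/
def phiMinus (a : ℝ) (f : Torus → ℝ → ℝ) (θ : Torus2) : ℝ :=
  sInf {y : ℝ | (θ, y) ∈ globalAttractor a f}

/-- The graph of a function on the two-torus. -/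
def graphOf (φ : Torus2 → ℝ) : Set (Torus2 × ℝ) := {p | p.2 = φ p.1}

/-- The set `P` of pinched points. -/
def pinched (a : ℝ) (f : Torus → ℝ → ℝ) : Set Torus2 :=
  {θ | phiPlus a f θ = phiMinus a f θ}

/-- The set `𝒫`, the closure of the graph of `φ⁺` (equivalently `φ⁻`) restricted to `P`. -/
def pinchedClosure (a : ℝ) (f : Torus → ℝ → ℝ) : Set (Torus2 × ℝ) :=
  closure {p | p.1 ∈ pinched a f ∧ p.2 = phiPlus a f p.1}

/-- Case B of the topological classification: `P = C⁺ ∩ C⁻`, where `C^±` is the set of continuity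
points of `φ^±`, and this is a dense `G_δ` set. -/
def CaseB (a : ℝ) (f : Torus → ℝ → ℝ) : Prop :=
  pinched a f = {θ | ContinuousAt (phiPlus a f) θ} ∩ {θ | ContinuousAt (phiMinus a f) θ} ∧
    IsGδ (pinched a f) ∧ Dense (pinched a f)

/-- The property that defines case B1: `𝒫` has more than one point in `I` over some `θ`. -/
def CaseB1 (a : ℝ) (f : Torus → ℝ → ℝ) (I : Set ℝ) : Prop :=
  ∃ θ : Torus2, 1 < {y : ℝ | y ∈ I ∧ (θ, y) ∈ pinchedClosure a f}.encard

/-- The lift of a function on the two-torus to a doubly periodic function on the plane. -/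
def lift2 (φ : Torus2 → ℝ) (p : ℝ × ℝ) : ℝ := φ ((p.1 : Torus), (p.2 : Torus))

/-- Class `C^{1+Lip}` on the two-torus: continuously differentiable with Lipschitz derivative. -/
def IsC1Lip (φ : Torus2 → ℝ) : Prop :=
  ContDiff ℝ 1 (lift2 φ) ∧ ∃ K : NNReal, LipschitzWith K (fderiv ℝ (lift2 φ))

end

/-- The standing assumptions on the fibre maps `f_x` over the baker map with parameter `a`, with the
intervals `I = [s, t]` and `J = [s', t']`. -/
structure Standing (a : ℝ) (f : Torus → ℝ → ℝ) (s t s' t' : ℝ) : Prop where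
  a_pos : 0 < a
  a_lt_one : a < 1
  smooth_fibre : ∀ x, ContDiff ℝ 3 (f x)
  deriv_pos : ∀ x y, 0 < deriv (f x) y
  schwarzian_neg : ∀ x y, schwarzian (f x) y < 0
  bounded : ∃ M : ℝ, ∀ x y, |f x y| ≤ M
  /-- `x ↦ f_x` is continuous, locally uniformly in `y`. -/
  cont : Continuous fun p : Torus × ℝ => f p.1 p.2
  I_subset : Set.Icc s t ⊆ interior (Set.Icc s' t')
  maps_J : ∀ x, ∀ y ∈ Set.Icc s' t', f x y ∈ interior (Set.Icc s t)
  /-- `inf τ'(x) f'_{τ(x)}(y) > 1` over `x ∈ 𝕋`, `y ∈ J`. -/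
  partially_hyperbolic : ∃ c : ℝ, 1 < c ∧
    ∀ x, ∀ y ∈ Set.Icc s' t', c ≤ tauSlope a x * deriv (f (tau a x)) y
  /-- `(x, y) ↦ f_x(y)` is of class `C²` on `𝕋 × J`. -/
  smooth_joint : ContDiffOn ℝ 2 (fun p : ℝ × ℝ => f (p.1 : Torus) p.2)
    (Set.univ ×ˢ Set.Icc s' t')
  /-- `φ⁺` and `φ⁻` take values in `I`. -/
  phi_mem : ∀ θ, phiPlus a f θ ∈ Set.Icc s t ∧ phiMinus a f θ ∈ Set.Icc s t

end BakerSkew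

open Set Filter Topology MeasureTheory

namespace BakerSkew

/-! ### The circle map and the baker map -/

/-! The second coordinate of a preimage under `baker` is recovered by `tau`. The fibre of the
attractor over `(ξ, x)` is therefore the decreasing intersection of images of `[-M, M]` under
compositions along the `tau`-orbit of `x`. So `φ^±` depend on `x` only, are monotone limits of
continuous functions, and are invariant under the inverse branches `x ↦ a x` and `x ↦ a + (1 - a)
x`. When `φ^+` (or `φ^-`) is continuous, the first two claims of b) follow from density of `P`
alone; the third follows from a) by comparing graphs.

The core of a) is that `φ^+` is Lipschitz on `P` (`LiftedSystem.exists_lipschitz`). Suppose two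
points of `P` had a vertical gap larger than `L` times their distance. Points of `P` are continuity
points, so the gap persists for all `u`, `v` near them. Apply one common word of inverse branches to
`u` and `v`: partial hyperbolicity makes the ratio of base distance to gap decay geometrically.
Negative Schwarzian derivative makes the cross ratio of `φ^-(u) ≤ φ^+(u) < φ^-(v) ≤ φ^+(v)`
nondecreasing for a single map (`cross_ratio_le`). The two fibres carry slightly different maps, but
the resulting errors are summable, so at least half of the cross ratio survives
(`LiftedSystem.exists_crossRatio_bound`). Since `P` is null, most fibres have length at least some
`δ`. An averaging choice of the word (`exists_volume_preimage_branchComp_le`) sends suitable `u`,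
`v` into such fibres, where the cross ratio forces a definite gap. The base points have meanwhile
become arbitrarily close, and `φ^+` is almost continuous off a small set: a contradiction.

The Lipschitz function extends from `P` to an invariant `ℓ` on `[0, 1]`. Linearizing invariance
along `x ↦ a x` gives a contracting equation for the derivative, and the first-order remainder
contracts to a quadratic one (`SecondOrder.exists_quadratic`). Values and slopes agree at `0` and
`1` (`SecondOrder.match_ends`), so the quadratic bounds become periodic, and uniform quadratic
Taylor bounds are exactly `C^{1+Lip}` regularity. -/

theorem rep_mem (x : Torus) : rep x ∈ Ico (0 : ℝ) 1 := by
  have h := (AddCircle.equivIco (1 : ℝ) 0 x).2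
  exact ⟨h.1, lt_of_lt_of_eq h.2 (zero_add 1)⟩

theorem coe_rep (x : Torus) : ((rep x : ℝ) : Torus) = x := AddCircle.coe_equivIco

theorem rep_coe {x : ℝ} (hx : x ∈ Ico (0 : ℝ) 1) : rep (x : Torus) = x := by
  have h := AddCircle.coe_equivIco_mk_apply (1 : ℝ) x
  rw [div_one, mul_one, Int.fract_eq_self.2 ⟨hx.1, hx.2⟩] at h
  exact h

theorem coe_one_torus : ((1 : ℝ) : Torus) = ((0 : ℝ) : Torus) := by
  have h := AddCircle.coe_period (1 : ℝ)
  rw [h, AddCircle.coe_zero]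

theorem rep_zero : rep ((0 : ℝ) : Torus) = 0 := rep_coe ⟨le_rfl, one_pos⟩

/-- The endpoint `x = 1` is included: `a` already lies on the other branch, but the values agree
since `1 = 0` on the circle. Invariance on the closed interval is what later ties the two ends
together. -/
theorem tau_mul {a x : ℝ} (ha : 0 < a) (ha1 : a < 1) (hx : x ∈ Icc (0 : ℝ) 1) :
    tau a ((a * x : ℝ) : Torus) = (x : Torus) := by
  have hr : rep ((a * x : ℝ) : Torus) = a * x :=
    rep_coe ⟨mul_nonneg ha.le hx.1, by nlinarith [hx.2]⟩
  unfold tau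
  rw [hr]
  rcases hx.2.lt_or_eq with h | h
  · rw [if_pos (by nlinarith), inv_mul_cancel_left₀ ha.ne']
  · rw [h, if_neg (by simp), mul_one, sub_self, mul_zero, coe_one_torus]

theorem tau_add_mul {a x : ℝ} (ha : 0 < a) (ha1 : a < 1) (hx : x ∈ Icc (0 : ℝ) 1) :
    tau a ((a + (1 - a) * x : ℝ) : Torus) = (x : Torus) := by
  have h1a : 0 < 1 - a := sub_pos.2 ha1
  unfold tau
  rcases hx.2.lt_or_eq with h | h
  · have hr : rep ((a + (1 - a) * x : ℝ) : Torus) = a + (1 - a) * x :=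
      rep_coe ⟨add_nonneg ha.le (mul_nonneg h1a.le hx.1), by nlinarith⟩
    rw [hr, if_neg (by nlinarith [mul_nonneg h1a.le hx.1]), add_sub_cancel_left,
      inv_mul_cancel_left₀ h1a.ne']
  · have e : a + (1 - a) * x = 1 := by rw [h]; ring
    rw [e, coe_one_torus, rep_zero, if_pos ha, mul_zero, h, coe_one_torus]

theorem tauSlope_mul {a x : ℝ} (ha : 0 < a) (ha1 : a < 1) (hx : x ∈ Ico (0 : ℝ) 1) :
    tauSlope a ((a * x : ℝ) : Torus) = a⁻¹ := by
  have hr : rep ((a * x : ℝ) : Torus) = a * x :=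
    rep_coe ⟨mul_nonneg ha.le hx.1, by nlinarith [hx.2]⟩
  unfold tauSlope
  rw [hr, if_pos (by nlinarith [hx.2])]

theorem tauSlope_add_mul {a x : ℝ} (ha : 0 < a) (ha1 : a < 1) (hx : x ∈ Ico (0 : ℝ) 1) :
    tauSlope a ((a + (1 - a) * x : ℝ) : Torus) = (1 - a)⁻¹ := by
  have h1a : 0 < 1 - a := sub_pos.2 ha1
  have hr : rep ((a + (1 - a) * x : ℝ) : Torus) = a + (1 - a) * x :=
    rep_coe ⟨add_nonneg ha.le (mul_nonneg h1a.le hx.1), by nlinarith [hx.2]⟩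
  unfold tauSlope
  rw [hr, if_neg (by nlinarith [mul_nonneg h1a.le hx.1])]

/-- Both branches are full, so the one-sided values at `a` and at `0` coincide on the circle.
Continuity of the pullbacks, and hence measurability of `φ^±`, rests on this. -/
theorem continuous_tau {a : ℝ} (ha : 0 < a) (ha1 : a < 1) : Continuous (tau a) := by
  have h1a : 0 < 1 - a := sub_pos.2 ha1
  let g : ℝ → Torus := fun r =>
    if r ≤ a then ((a⁻¹ * r : ℝ) : Torus) else (((1 - a)⁻¹ * (r - a) : ℝ) : Torus)
  have hg : Continuous g := by
    refine Continuous.if_le ?_ ?_ continuous_id continuous_const ?_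
    · exact (AddCircle.continuous_mk' 1).comp (by fun_prop)
    · exact (AddCircle.continuous_mk' 1).comp (by fun_prop)
    · intro r hr
      replace hr : r = a := hr
      rw [hr, inv_mul_cancel₀ ha.ne', sub_self, mul_zero, coe_one_torus]
  have hg01 : g 0 = g 1 := by
    simp only [g]
    rw [if_pos ha.le, if_neg (not_le.2 ha1), mul_zero, inv_mul_cancel₀ h1a.ne', coe_one_torus]
  have key : tau a = AddCircle.liftIco 1 0 g := by
    funext x
    have hx := rep_mem x
    conv_rhs => rw [← coe_rep x]
    rw [AddCircle.liftIco_zero_coe_apply hx]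
    simp only [g, tau]
    rcases lt_trichotomy (rep x) a with h | h | h
    · rw [if_pos h, if_pos h.le]
    · rw [if_neg (by rw [h]; exact lt_irrefl a), if_pos h.le, h, inv_mul_cancel₀ ha.ne', sub_self,
        mul_zero, coe_one_torus]
    · rw [if_neg (not_lt.2 h.le), if_neg (not_le.2 h)]
  rw [key]
  exact AddCircle.liftIco_zero_continuous hg01 hg.continuousOn

theorem tau_baker_snd {a : ℝ} (ha : 0 < a) (ha1 : a < 1) (θ : Torus2) :
    tau a (baker a θ).2 = θ.2 := by
  have h := rep_mem θ.2
  unfold baker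
  dsimp only
  split_ifs
  · rw [tau_mul ha ha1 ⟨h.1, h.2.le⟩, coe_rep]
  · rw [tau_add_mul ha ha1 ⟨h.1, h.2.le⟩, coe_rep]

theorem baker_surjective {a : ℝ} (ha : 0 < a) (ha1 : a < 1) : Function.Surjective (baker a) := by
  rintro ⟨ξ, x⟩
  have h1a : 0 < 1 - a := sub_pos.2 ha1
  have hξ := rep_mem ξ
  have hx := rep_mem x
  by_cases h : rep x < a
  · have h1 : a⁻¹ * rep x ∈ Ico (0 : ℝ) 1 :=
      ⟨mul_nonneg (inv_nonneg.2 ha.le) hx.1, by rwa [inv_mul_lt_iff₀ ha, mul_one]⟩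
    refine ⟨(((a * rep ξ : ℝ) : Torus), ((a⁻¹ * rep x : ℝ) : Torus)), ?_⟩
    have h2 : rep ((a * rep ξ : ℝ) : Torus) = a * rep ξ :=
      rep_coe ⟨mul_nonneg ha.le hξ.1, by nlinarith [hξ.2]⟩
    unfold baker
    dsimp only
    rw [tau_mul ha ha1 ⟨hξ.1, hξ.2.le⟩, h2, if_pos (by nlinarith [hξ.2]), rep_coe h1,
      mul_inv_cancel_left₀ ha.ne', coe_rep, coe_rep]
  · have h0 := not_lt.1 h
    have h1 : (1 - a)⁻¹ * (rep x - a) ∈ Ico (0 : ℝ) 1 :=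
      ⟨mul_nonneg (inv_nonneg.2 h1a.le) (sub_nonneg.2 h0), by
        rw [inv_mul_lt_iff₀ h1a]; linarith [hx.2]⟩
    refine ⟨(((a + (1 - a) * rep ξ : ℝ) : Torus), (((1 - a)⁻¹ * (rep x - a) : ℝ) : Torus)), ?_⟩
    have h2 : rep ((a + (1 - a) * rep ξ : ℝ) : Torus) = a + (1 - a) * rep ξ :=
      rep_coe ⟨add_nonneg ha.le (mul_nonneg h1a.le hξ.1), by nlinarith [hξ.2]⟩
    unfold baker
    dsimp only
    rw [tau_add_mul ha ha1 ⟨hξ.1, hξ.2.le⟩, h2,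
      if_neg (by nlinarith [mul_nonneg h1a.le hξ.1]), rep_coe h1,
      mul_inv_cancel_left₀ h1a.ne', add_sub_cancel, coe_rep, coe_rep]

/-! ### The fibres of the global attractor -/

/-- The fibre map `f_{τ x} ∘ f_{τ² x} ∘ ⋯ ∘ f_{τⁿ x}` over the base point `x`. -/
noncomputable def pullback (a : ℝ) (f : Torus → ℝ → ℝ) : ℕ → Torus → ℝ → ℝ
  | 0, _, y => y
  | n + 1, x, y => f (tau a x) (pullback a f n (tau a x) y)

/-- Peeling off the innermost map, whose values lie in `[-M, M]`, is what makes the pullbacks of `M`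
and `-M` monotone in `n`. -/
theorem pullback_succ' (a : ℝ) (f : Torus → ℝ → ℝ) (n : ℕ) (x : Torus) (y : ℝ) :
    pullback a f (n + 1) x y = pullback a f n x (f ((tau a)^[n + 1] x) y) := by
  induction n generalizing x with
  | zero => rfl
  | succ n ih =>
    rw [pullback, ih (tau a x), ← Function.iterate_succ_apply]
    rfl

theorem mem_iterate_skew {a : ℝ} (ha : 0 < a) (ha1 : a < 1) (f : Torus → ℝ → ℝ) (n : ℕ)
    (θ : Torus2) (y : ℝ) :
    (θ, y) ∈ (skew a f)^[n] '' univ ↔ y ∈ range (pullback a f n θ.2) := by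
  induction n generalizing θ y with
  | zero =>
    constructor
    · intro _; exact ⟨y, rfl⟩
    · intro _; exact ⟨(θ, y), mem_univ _, rfl⟩
  | succ n ih =>
    rw [Function.iterate_succ', image_comp]
    constructor
    · rintro ⟨⟨θ', y'⟩, h, he⟩
      obtain ⟨z, hz⟩ := (ih θ' y').1 h
      have h1 : baker a θ' = θ := congrArg Prod.fst he
      have h2 : f θ'.2 y' = y := congrArg Prod.snd he
      refine ⟨z, ?_⟩
      rw [pullback, ← h1, tau_baker_snd ha ha1, hz, h2]
    · rintro ⟨z, hz⟩
      obtain ⟨θ', rfl⟩ := baker_surjective ha ha1 θ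
      rw [pullback, tau_baker_snd ha ha1] at hz
      refine ⟨(θ', pullback a f n θ'.2 z), (ih _ _).2 ⟨z, rfl⟩, ?_⟩
      exact Prod.ext rfl hz

section Fibres

variable {a : ℝ} {f : Torus → ℝ → ℝ} {s t s' t' : ℝ}

theorem Standing.strictMono (hf : Standing a f s t s' t') (x : Torus) : StrictMono (f x) :=
  strictMono_of_deriv_pos (hf.deriv_pos x)

theorem Standing.strictMono_pullback (hf : Standing a f s t s' t') (n : ℕ) (x : Torus) :
    StrictMono (pullback a f n x) := by
  induction n generalizing x with
  | zero => exact strictMono_id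
  | succ n ih => exact (hf.strictMono _).comp (ih _)

theorem Standing.continuous_pullback (hf : Standing a f s t s' t') (n : ℕ) :
    Continuous fun p : Torus × ℝ => pullback a f n p.1 p.2 := by
  induction n with
  | zero => exact continuous_snd
  | succ n ih =>
    have hτ : Continuous fun p : Torus × ℝ => tau a p.1 :=
      (continuous_tau hf.a_pos hf.a_lt_one).comp continuous_fst
    exact hf.cont.comp (hτ.prodMk (ih.comp (hτ.prodMk continuous_snd)))

variable {M : ℝ}

theorem Standing.antitone_pullback (hf : Standing a f s t s' t') (hM : ∀ x y, |f x y| ≤ M)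
    (x : Torus) : Antitone fun n => pullback a f n x M := by
  refine antitone_nat_of_succ_le fun n => ?_
  rw [pullback_succ']
  exact (hf.strictMono_pullback n x).monotone (abs_le.1 (hM _ _)).2

theorem Standing.monotone_pullback (hf : Standing a f s t s' t') (hM : ∀ x y, |f x y| ≤ M)
    (x : Torus) : Monotone fun n => pullback a f n x (-M) := by
  refine monotone_nat_of_le_succ fun n => ?_
  rw [pullback_succ']
  exact (hf.strictMono_pullback n x).monotone (abs_le.1 (hM _ _)).1

theorem Standing.pullback_le_pullback (hf : Standing a f s t s' t') (hM : ∀ x y, |f x y| ≤ M)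
    (x : Torus) (m n : ℕ) : pullback a f m x (-M) ≤ pullback a f n x M := by
  have h0 : -M ≤ M := by
    have := hM 0 0
    linarith [abs_nonneg (f 0 0)]
  exact (hf.monotone_pullback hM x (le_max_left m n)).trans
    (((hf.strictMono_pullback _ x).monotone h0).trans
      (hf.antitone_pullback hM x (le_max_right m n)))

theorem Standing.mem_globalAttractor (hf : Standing a f s t s' t') (hM : ∀ x y, |f x y| ≤ M)
    (θ : Torus2) (y : ℝ) :
    (θ, y) ∈ globalAttractor a f ↔
      ∀ n, y ∈ Icc (pullback a f n θ.2 (-M)) (pullback a f n θ.2 M) := by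
  have h0 : -M ≤ M := by
    have := hM 0 0
    linarith [abs_nonneg (f 0 0)]
  unfold globalAttractor
  rw [mem_iInter]
  constructor
  · intro h n
    -- One extra iterate is used: the innermost map sends an arbitrary real into `[-M, M]`, and the
    -- remaining `n` maps are monotone.
    obtain ⟨z, hz⟩ := (mem_iterate_skew hf.a_pos hf.a_lt_one f (n + 1) θ y).1 (h (n + 1))
    rw [pullback_succ'] at hz
    have hb := abs_le.1 (hM ((tau a)^[n + 1] θ.2) z)
    rw [← hz]
    exact ⟨(hf.strictMono_pullback n _).monotone hb.1, (hf.strictMono_pullback n _).monotone hb.2⟩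
  · intro h n
    rw [mem_iterate_skew hf.a_pos hf.a_lt_one]
    have hc : Continuous (pullback a f n θ.2) :=
      (hf.continuous_pullback n).comp (continuous_const.prodMk continuous_id)
    obtain ⟨z, -, hz⟩ := intermediate_value_Icc h0 hc.continuousOn (h n)
    exact ⟨z, hz⟩

theorem Standing.fibre_eq (hf : Standing a f s t s' t') (hM : ∀ x y, |f x y| ≤ M) (θ : Torus2) :
    {y | (θ, y) ∈ globalAttractor a f} =
      Icc (⨆ n, pullback a f n θ.2 (-M)) (⨅ n, pullback a f n θ.2 M) := by
  ext y
  rw [mem_ofPred_eq, hf.mem_globalAttractor hM]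
  constructor
  · intro h
    exact ⟨ciSup_le fun n => (h n).1, le_ciInf fun n => (h n).2⟩
  · intro h n
    refine ⟨le_trans (le_ciSup (f := fun n => pullback a f n θ.2 (-M)) ?_ n) h.1,
      le_trans h.2 (ciInf_le (f := fun n => pullback a f n θ.2 M) ?_ n)⟩
    · exact ⟨_, forall_mem_range.2 fun m => hf.pullback_le_pullback hM _ m 0⟩
    · exact ⟨_, forall_mem_range.2 fun m => hf.pullback_le_pullback hM _ 0 m⟩

theorem Standing.iSup_le_iInf (hf : Standing a f s t s' t') (hM : ∀ x y, |f x y| ≤ M)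
    (x : Torus) : ⨆ n, pullback a f n x (-M) ≤ ⨅ n, pullback a f n x M :=
  ciSup_le fun m => le_ciInf fun n => hf.pullback_le_pullback hM x m n

theorem Standing.tendsto_phiPlus (hf : Standing a f s t s' t') (hM : ∀ x y, |f x y| ≤ M)
    (θ : Torus2) : Tendsto (fun n => pullback a f n θ.2 M) atTop (𝓝 (phiPlus a f θ)) := by
  rw [phiPlus, hf.fibre_eq hM, csSup_Icc (hf.iSup_le_iInf hM _)]
  exact tendsto_atTop_ciInf (hf.antitone_pullback hM _)
    ⟨_, forall_mem_range.2 fun m => hf.pullback_le_pullback hM _ 0 m⟩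

theorem Standing.tendsto_phiMinus (hf : Standing a f s t s' t') (hM : ∀ x y, |f x y| ≤ M)
    (θ : Torus2) : Tendsto (fun n => pullback a f n θ.2 (-M)) atTop (𝓝 (phiMinus a f θ)) := by
  rw [phiMinus, hf.fibre_eq hM, csInf_Icc (hf.iSup_le_iInf hM _)]
  exact tendsto_atTop_ciSup (hf.monotone_pullback hM _)
    ⟨_, forall_mem_range.2 fun m => hf.pullback_le_pullback hM _ m 0⟩

theorem Standing.phiMinus_le_phiPlus (hf : Standing a f s t s' t') (θ : Torus2) :
    phiMinus a f θ ≤ phiPlus a f θ := by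
  obtain ⟨M, hM⟩ := hf.bounded
  rw [phiPlus, phiMinus, hf.fibre_eq hM, csSup_Icc (hf.iSup_le_iInf hM _),
    csInf_Icc (hf.iSup_le_iInf hM _)]
  exact hf.iSup_le_iInf hM _

theorem Standing.phiPlus_eq (hf : Standing a f s t s' t') (ξ ξ' x : Torus) :
    phiPlus a f (ξ, x) = phiPlus a f (ξ', x) := by
  obtain ⟨M, hM⟩ := hf.bounded
  exact tendsto_nhds_unique (hf.tendsto_phiPlus hM (ξ, x)) (hf.tendsto_phiPlus hM (ξ', x))

theorem Standing.phiMinus_eq (hf : Standing a f s t s' t') (ξ ξ' x : Torus) :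
    phiMinus a f (ξ, x) = phiMinus a f (ξ', x) := by
  obtain ⟨M, hM⟩ := hf.bounded
  exact tendsto_nhds_unique (hf.tendsto_phiMinus hM (ξ, x)) (hf.tendsto_phiMinus hM (ξ', x))

theorem Standing.continuous_fibre (hf : Standing a f s t s' t') (x : Torus) :
    Continuous (f x) := (hf.smooth_fibre x).continuous

theorem Standing.phiPlus_tau (hf : Standing a f s t s' t') (ξ x : Torus) :
    phiPlus a f (ξ, x) = f (tau a x) (phiPlus a f (ξ, tau a x)) := by
  obtain ⟨M, hM⟩ := hf.bounded
  exact tendsto_nhds_unique ((tendsto_add_atTop_iff_nat 1).2 (hf.tendsto_phiPlus hM (ξ, x)))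
    (((hf.continuous_fibre _).tendsto _).comp (hf.tendsto_phiPlus hM (ξ, tau a x)))

theorem Standing.phiMinus_tau (hf : Standing a f s t s' t') (ξ x : Torus) :
    phiMinus a f (ξ, x) = f (tau a x) (phiMinus a f (ξ, tau a x)) := by
  obtain ⟨M, hM⟩ := hf.bounded
  exact tendsto_nhds_unique ((tendsto_add_atTop_iff_nat 1).2 (hf.tendsto_phiMinus hM (ξ, x)))
    (((hf.continuous_fibre _).tendsto _).comp (hf.tendsto_phiMinus hM (ξ, tau a x)))

end Fibres

/-! ### Negative Schwarzian derivative and cross ratios -/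

section Schwarzian

variable {g : ℝ → ℝ}

theorem hasDerivAt_deriv_of_contDiff_three (hg : ContDiff ℝ 3 g) (y : ℝ) :
    HasDerivAt (deriv g) (iteratedDeriv 2 g y) y := by
  have h1 : ContDiff ℝ 2 (deriv g) := hg.deriv'
  have h2 : iteratedDeriv 2 g = deriv (deriv g) := by
    rw [iteratedDeriv_succ, iteratedDeriv_one]
  rw [h2]
  exact (h1.differentiable (by norm_num) y).hasDerivAt

theorem hasDerivAt_iteratedDeriv_two (hg : ContDiff ℝ 3 g) (y : ℝ) :
    HasDerivAt (iteratedDeriv 2 g) (iteratedDeriv 3 g y) y := by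
  rw [iteratedDeriv_succ (n := 2)]
  exact (hg.differentiable_iteratedDeriv 2 (by norm_num) y).hasDerivAt

/-- If `g' > 0` and `g` has negative Schwarzian derivative, then `1 / √g'` is convex. -/
theorem convexOn_deriv_rpow (hg : ContDiff ℝ 3 g) (hpos : ∀ y, 0 < deriv g y)
    (hS : ∀ y, schwarzian g y < 0) :
    ConvexOn ℝ univ fun y => deriv g y ^ (-(1 / 2) : ℝ) := by
  have h1 : ∀ y, HasDerivAt (fun y => deriv g y ^ (-(1 / 2) : ℝ))
      (iteratedDeriv 2 g y * (-(1 / 2)) * deriv g y ^ (-(1 / 2) - 1 : ℝ)) y := fun y =>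
    (hasDerivAt_deriv_of_contDiff_three hg y).rpow_const (Or.inl (hpos y).ne')
  have hd1 : deriv (fun y => deriv g y ^ (-(1 / 2) : ℝ)) =
      fun y => iteratedDeriv 2 g y * (-(1 / 2)) * deriv g y ^ (-(1 / 2) - 1 : ℝ) :=
    funext fun y => (h1 y).deriv
  have h2 : ∀ y, HasDerivAt
      (fun y => iteratedDeriv 2 g y * (-(1 / 2)) * deriv g y ^ (-(1 / 2) - 1 : ℝ))
      (iteratedDeriv 3 g y * (-(1 / 2)) * deriv g y ^ (-(1 / 2) - 1 : ℝ) +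
        iteratedDeriv 2 g y * (-(1 / 2)) *
          (iteratedDeriv 2 g y * (-(1 / 2) - 1) * deriv g y ^ (-(1 / 2) - 1 - 1 : ℝ))) y :=
    fun y => ((hasDerivAt_iteratedDeriv_two hg y).mul_const _).mul
      ((hasDerivAt_deriv_of_contDiff_three hg y).rpow_const (Or.inl (hpos y).ne'))
  refine convexOn_univ_of_deriv2_nonneg (fun y => (h1 y).differentiableAt) ?_ ?_
  · rw [hd1]; exact fun y => (h2 y).differentiableAt
  · intro y
    -- The second derivative of `(g')^(-1/2)` is `-1/2 · (g')^(-1/2)` times the Schwarzian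
    -- derivative of `g`.
    have : deriv^[2] (fun y => deriv g y ^ (-(1 / 2) : ℝ)) y =
        -(1 / 2) * deriv g y ^ (-(1 / 2) : ℝ) * schwarzian g y := by
      rw [Function.iterate_succ, Function.iterate_one, Function.comp_apply, hd1, (h2 y).deriv,
        schwarzian]
      simp only [Real.rpow_sub_one (hpos y).ne']
      have := (hpos y).ne'
      field_simp
      ring
    rw [this]
    have hp : 0 < deriv g y ^ (-(1 / 2) : ℝ) := Real.rpow_pos_of_pos (hpos y) _
    nlinarith [hS y, mul_pos hp (neg_pos.2 (hS y))]

/-- Two-point distortion estimate for maps with negative Schwarzian derivative. -/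
theorem deriv_mul_deriv_le (hg : ContDiff ℝ 3 g) (hpos : ∀ y, 0 < deriv g y)
    (hS : ∀ y, schwarzian g y < 0) {x y : ℝ} (hxy : x < y) :
    deriv g x * deriv g y * (y - x) ^ 2 ≤ (g y - g x) ^ 2 := by
  set h : ℝ → ℝ := fun y => deriv g y ^ (-(1 / 2) : ℝ) with hh
  have hhpos : ∀ z, 0 < h z := fun z => Real.rpow_pos_of_pos (hpos z) _
  have hsq : ∀ z, deriv g z = (h z ^ 2)⁻¹ := fun z => by
    rw [hh, ← Real.rpow_natCast, ← Real.rpow_mul (hpos z).le, ← Real.rpow_neg (hpos z).le]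
    norm_num
  have hconv := convexOn_deriv_rpow hg hpos hS
  set m := (h y - h x) / (y - x) with hm
  have hyx : 0 < y - x := sub_pos.2 hxy
  have hlin : ∀ z ∈ Icc x y, h z ≤ h x + m * (z - x) := by
    intro z hz
    have hz1 : 0 ≤ (y - z) / (y - x) := div_nonneg (sub_nonneg.2 hz.2) hyx.le
    have hz2 : 0 ≤ (z - x) / (y - x) := div_nonneg (sub_nonneg.2 hz.1) hyx.le
    have hs : (y - z) / (y - x) + (z - x) / (y - x) = 1 := by field_simp; ring
    have := hconv.2 (mem_univ x) (mem_univ y) hz1 hz2 hs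
    have e1 : ((y - z) / (y - x)) • x + ((z - x) / (y - x)) • y = z := by
      simp only [smul_eq_mul]; field_simp; ring
    rw [e1] at this
    refine this.trans_eq ?_
    simp only [smul_eq_mul, hm]
    change (y - z) / (y - x) * h x + (z - x) / (y - x) * h y = _
    field_simp; ring
  have hlpos : ∀ z ∈ Icc x y, 0 < h x + m * (z - x) := fun z hz => (hhpos z).trans_le (hlin z hz)
  have hgd : ∀ z, HasDerivAt g (deriv g z) z := fun z =>
    (hg.differentiable (by norm_num) z).hasDerivAt
  -- The subtracted term is the primitive, vanishing at `x`, of the inverse square of the chord of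
  -- `h`. Convexity puts `h` below its chord, so `g' = h⁻²` dominates the integrand and the
  -- difference increases.
  have hder : ∀ z ∈ Icc x y, HasDerivAt (fun z => g z - (z - x) / ((h x + m * (z - x)) * h x))
      (deriv g z - ((h x + m * (z - x)) ^ 2)⁻¹) z := by
    intro z hz
    have hl := (hlpos z hz).ne'
    have hx0 := (hhpos x).ne'
    have d1 : HasDerivAt (fun z : ℝ => z - x) 1 z := (hasDerivAt_id z).sub_const x
    have d2 : HasDerivAt (fun z : ℝ => (h x + m * (z - x)) * h x) (m * 1 * h x) z :=
      ((d1.const_mul m).const_add (h x)).mul_const (h x)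
    have d3 := (hgd z).sub (d1.div d2 (mul_ne_zero hl hx0))
    refine d3.congr_deriv ?_
    field_simp
    ring
  have hmono : MonotoneOn (fun z => g z - (z - x) / ((h x + m * (z - x)) * h x)) (Icc x y) := by
    refine monotoneOn_of_deriv_nonneg (convex_Icc x y)
      (fun z hz => (hder z hz).continuousAt.continuousWithinAt)
      (fun z hz => (hder z (interior_subset hz)).differentiableAt.differentiableWithinAt) ?_
    intro z hz
    have hz' := interior_subset hz
    rw [(hder z hz').deriv, sub_nonneg, hsq z]
    exact inv_anti₀ (by have := hhpos z; positivity)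
      (pow_le_pow_left₀ (hhpos z).le (hlin z hz') 2)
  have hfin := hmono (left_mem_Icc.2 hxy.le) (right_mem_Icc.2 hxy.le) hxy.le
  have e2 : h x + m * (y - x) = h y := by rw [hm]; field_simp; ring
  simp only [sub_self, zero_div, sub_zero] at hfin
  rw [e2] at hfin
  have hle : (y - x) / (h y * h x) ≤ g y - g x := by linarith
  have hnn : 0 ≤ (y - x) / (h y * h x) :=
    div_nonneg hyx.le (mul_nonneg (hhpos y).le (hhpos x).le)
  have := pow_le_pow_left₀ hnn hle 2
  refine le_trans (le_of_eq ?_) this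
  rw [hsq x, hsq y]
  have := (hhpos x).ne'
  have := (hhpos y).ne'
  field_simp

/-- As a function of the far endpoint `w`, the expression has derivative `1 / (w - x)² - g'(x) g'(w)
/ (g w - g x)²`, nonnegative by the two-point estimate. -/
theorem deriv_div_sub_le (hg : ContDiff ℝ 3 g) (hpos : ∀ y, 0 < deriv g y)
    (hS : ∀ y, schwarzian g y < 0) {x y z : ℝ} (hxy : x < y) (hyz : y ≤ z) :
    deriv g x / (g y - g x) - 1 / (y - x) ≤ deriv g x / (g z - g x) - 1 / (z - x) := by
  have hmono := strictMono_of_deriv_pos hpos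
  have hgd : ∀ z, HasDerivAt g (deriv g z) z := fun z =>
    (hg.differentiable (by norm_num) z).hasDerivAt
  have hder : ∀ w ∈ Ioi x, HasDerivAt (fun w => deriv g x / (g w - g x) - 1 / (w - x))
      ((0 * (g w - g x) - deriv g x * deriv g w) / (g w - g x) ^ 2 -
        (0 * (w - x) - 1 * 1) / (w - x) ^ 2) w := by
    intro w hw
    have h1 : g w - g x ≠ 0 := (sub_pos.2 (hmono hw)).ne'
    have h2 : w - x ≠ 0 := (sub_pos.2 (mem_Ioi.1 hw)).ne'
    exact ((hasDerivAt_const w (deriv g x)).div ((hgd w).sub_const (g x)) h1).sub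
      ((hasDerivAt_const w (1 : ℝ)).div ((hasDerivAt_id w).sub_const x) h2)
  have hm : MonotoneOn (fun w => deriv g x / (g w - g x) - 1 / (w - x)) (Ioi x) := by
    refine monotoneOn_of_deriv_nonneg (convex_Ioi x)
      (fun w hw => (hder w hw).continuousAt.continuousWithinAt)
      (fun w hw => (hder w (interior_subset hw)).differentiableAt.differentiableWithinAt) ?_
    intro w hw
    have hw' : x < w := interior_subset hw
    rw [(hder w hw').deriv]
    have h1 : 0 < (g w - g x) ^ 2 := pow_pos (sub_pos.2 (hmono hw')) 2
    have h2 : 0 < (w - x) ^ 2 := pow_pos (sub_pos.2 hw') 2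
    have h3 := deriv_mul_deriv_le hg hpos hS hw'
    have h4 : deriv g x * deriv g w / (g w - g x) ^ 2 ≤ 1 / (w - x) ^ 2 := by
      rw [div_le_div_iff₀ h1 h2]; linarith
    have e : (0 * (g w - g x) - deriv g x * deriv g w) / (g w - g x) ^ 2 -
        (0 * (w - x) - 1 * 1) / (w - x) ^ 2 =
        1 / (w - x) ^ 2 - deriv g x * deriv g w / (g w - g x) ^ 2 := by ring
    rw [e]
    linarith
  exact hm hxy (hxy.trans_le hyz) hyz

/-- Maps with negative Schwarzian derivative increase cross ratios. -/
theorem cross_ratio_le (hg : ContDiff ℝ 3 g) (hpos : ∀ y, 0 < deriv g y)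
    (hS : ∀ y, schwarzian g y < 0) {y₁ y₂ y₃ y₄ : ℝ} (h12 : y₁ ≤ y₂) (h23 : y₂ < y₃)
    (h34 : y₃ ≤ y₄) :
    (g y₃ - g y₁) * (g y₄ - g y₂) * ((y₄ - y₁) * (y₃ - y₂)) ≤
      (g y₄ - g y₁) * (g y₃ - g y₂) * ((y₃ - y₁) * (y₄ - y₂)) := by
  have hmono := strictMono_of_deriv_pos hpos
  have hgd : ∀ z, HasDerivAt g (deriv g z) z := fun z =>
    (hg.differentiable (by norm_num) z).hasDerivAt
  have hlog : ∀ b, ∀ x < b, HasDerivAt (fun x => Real.log (g b - g x) - Real.log (b - x))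
      (-deriv g x / (g b - g x) - -1 / (b - x)) x := by
    intro b x hx
    exact (((hgd x).const_sub (g b)).log (sub_pos.2 (hmono hx)).ne').sub
      (((hasDerivAt_id x).const_sub b).log (sub_pos.2 hx).ne')
  have hder : ∀ x ∈ Iio y₃, HasDerivAt (fun x => Real.log (g y₄ - g x) - Real.log (y₄ - x) -
      (Real.log (g y₃ - g x) - Real.log (y₃ - x)))
      (-deriv g x / (g y₄ - g x) - -1 / (y₄ - x) -
        (-deriv g x / (g y₃ - g x) - -1 / (y₃ - x))) x := fun x hx =>
    (hlog y₄ x (lt_of_lt_of_le hx h34)).sub (hlog y₃ x hx)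
  -- The logarithm of a ratio of difference quotients with common endpoint `x`; comparing its values
  -- at `x = y₁` and `x = y₂` is the logarithm of the cross-ratio inequality.
  have hanti : AntitoneOn (fun x => Real.log (g y₄ - g x) - Real.log (y₄ - x) -
      (Real.log (g y₃ - g x) - Real.log (y₃ - x))) (Iio y₃) := by
    refine antitoneOn_of_deriv_nonpos (convex_Iio y₃)
      (fun w hw => (hder w hw).continuousAt.continuousWithinAt)
      (fun w hw => (hder w (interior_subset hw)).differentiableAt.differentiableWithinAt) ?_
    intro w hw
    have hw' : w ∈ Iio y₃ := interior_subset hw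
    rw [(hder w hw').deriv]
    have := deriv_div_sub_le hg hpos hS hw' h34
    simp only [neg_div]
    linarith
  have h13 := h12.trans_lt h23
  have key := hanti (show y₁ ∈ Iio y₃ from h13) h23 h12
  have p1 : ∀ x y, x < y → 0 < g y - g x := fun x y h => sub_pos.2 (hmono h)
  have p2 : ∀ x y : ℝ, x < y → 0 < y - x := fun x y h => sub_pos.2 h
  have h24 := h23.trans_le h34
  have h14 := h13.trans_le h34
  have a1 := p1 _ _ h13
  have a2 := p1 _ _ h24
  have a3 := p1 _ _ h14
  have a4 := p1 _ _ h23
  have b1 := p2 _ _ h13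
  have b2 := p2 _ _ h24
  have b3 := p2 _ _ h14
  have b4 := p2 _ _ h23
  rw [← Real.log_le_log_iff (by positivity) (by positivity)]
  rw [Real.log_mul (by positivity) (by positivity), Real.log_mul a1.ne' a2.ne',
    Real.log_mul b3.ne' b4.ne', Real.log_mul (by positivity) (by positivity),
    Real.log_mul a3.ne' a4.ne', Real.log_mul b1.ne' b2.ne']
  simp only at key
  linarith

end Schwarzian

/-! ### Iterated contractions of the stable coordinate -/

/-- The affine inverse branches `x ↦ a x` and `x ↦ a + (1 - a) x` of `τ`. -/
def branch (a : ℝ) (b : Bool) (x : ℝ) : ℝ := bif b then a + (1 - a) * x else a * x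

/-- The slopes of the inverse branches of `τ`. -/
def branchSlope (a : ℝ) (b : Bool) : ℝ := bif b then 1 - a else a

/-- The composition of the inverse branches of `τ` given by a word. -/
def branchComp (a : ℝ) : List Bool → ℝ → ℝ
  | [], x => x
  | b :: l, x => branch a b (branchComp a l x)

theorem branch_sub (a : ℝ) (b : Bool) (x y : ℝ) :
    branch a b x - branch a b y = branchSlope a b * (x - y) := by
  cases b <;> simp only [branch, branchSlope, cond_true, cond_false] <;> ring

theorem branch_mem {a : ℝ} (ha : 0 < a) (ha1 : a < 1) (b : Bool) {x : ℝ}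
    (hx : x ∈ Icc (0 : ℝ) 1) : branch a b x ∈ Icc (0 : ℝ) 1 := by
  obtain ⟨h0, h1⟩ := hx
  cases b <;> simp only [branch, cond_true, cond_false] <;> constructor <;> nlinarith

theorem branchComp_mem {a : ℝ} (ha : 0 < a) (ha1 : a < 1) (l : List Bool) {x : ℝ}
    (hx : x ∈ Icc (0 : ℝ) 1) : branchComp a l x ∈ Icc (0 : ℝ) 1 := by
  induction l with
  | nil => exact hx
  | cons b l ih => exact branch_mem ha ha1 b ih

theorem branchSlope_pos {a : ℝ} (ha : 0 < a) (ha1 : a < 1) (b : Bool) : 0 < branchSlope a b := by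
  cases b
  · exact ha
  · exact sub_pos.2 ha1

theorem min_le_branchSlope (a : ℝ) (b : Bool) : min a (1 - a) ≤ branchSlope a b := by
  cases b
  · exact min_le_left _ _
  · exact min_le_right _ _

theorem branchSlope_le_max (a : ℝ) (b : Bool) : branchSlope a b ≤ max a (1 - a) := by
  cases b
  · exact le_max_left _ _
  · exact le_max_right _ _

theorem abs_branchComp_sub_le {a : ℝ} (ha : 0 < a) (ha1 : a < 1) (l : List Bool) (x y : ℝ) :
    |branchComp a l x - branchComp a l y| ≤ max a (1 - a) ^ l.length * |x - y| := by
  induction l with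
  | nil => simp [branchComp]
  | cons b l ih =>
    rw [branchComp, branchComp, branch_sub, abs_mul, abs_of_pos (branchSlope_pos ha ha1 b),
      List.length_cons, pow_succ', mul_assoc]
    exact mul_le_mul (branchSlope_le_max a b) ih (abs_nonneg _) (ha.le.trans (le_max_left _ _))

/-- The volumes of the two preimages, weighted by `a` and `1 - a`, average to the volume of `B`, so
at least one of them does not exceed it. -/
theorem exists_volume_preimage_branch_le {a : ℝ} (ha : 0 < a) (ha1 : a < 1) (B : Set ℝ) :
    ∃ b, volume (Ico (0 : ℝ) 1 ∩ branch a b ⁻¹' B) ≤ volume (Ico (0 : ℝ) 1 ∩ B) := by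
  have h1a : 0 < 1 - a := sub_pos.2 ha1
  have e0 : Ico (0 : ℝ) 1 ∩ branch a false ⁻¹' B = (fun x => a * x) ⁻¹' (Ico 0 a ∩ B) := by
    ext x
    simp only [branch, cond_false, mem_inter_iff, mem_Ico, mem_preimage]
    refine and_congr_left fun _ => and_congr ?_ ?_
    · rw [mul_nonneg_iff_of_pos_left ha]
    · rw [mul_lt_iff_lt_one_right ha]
  have e1 : Ico (0 : ℝ) 1 ∩ branch a true ⁻¹' B =
      (fun x => (1 - a) * x) ⁻¹' ((fun x => a + x) ⁻¹' (Ico a 1 ∩ B)) := by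
    ext x
    simp only [branch, cond_true, mem_inter_iff, mem_Ico, mem_preimage]
    refine and_congr_left fun _ => and_congr ?_ ?_
    · rw [le_add_iff_nonneg_right, mul_nonneg_iff_of_pos_left h1a]
    · rw [← lt_sub_iff_add_lt', mul_lt_iff_lt_one_right h1a]
  have v0 : volume (Ico (0 : ℝ) 1 ∩ branch a false ⁻¹' B) =
      ENNReal.ofReal a⁻¹ * volume (Ico 0 a ∩ B) := by
    rw [e0, Real.volume_preimage_mul_left ha.ne', abs_of_pos (inv_pos.2 ha)]
  have v1 : volume (Ico (0 : ℝ) 1 ∩ branch a true ⁻¹' B) =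
      ENNReal.ofReal (1 - a)⁻¹ * volume (Ico a 1 ∩ B) := by
    rw [e1, Real.volume_preimage_mul_left h1a.ne', abs_of_pos (inv_pos.2 h1a),
      measure_preimage_add]
  have split : volume (Ico (0 : ℝ) 1 ∩ B) = volume (Ico 0 a ∩ B) + volume (Ico a 1 ∩ B) := by
    rw [← measure_inter_add_sdiff (Ico (0 : ℝ) 1 ∩ B) (measurableSet_Iio (a := a))]
    congr 2
    · ext x; simp only [mem_inter_iff, mem_Ico, mem_Iio]
      constructor
      · rintro ⟨⟨⟨h1, -⟩, h2⟩, h3⟩; exact ⟨⟨h1, h3⟩, h2⟩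
      · rintro ⟨⟨h1, h3⟩, h2⟩; exact ⟨⟨⟨h1, h3.trans ha1⟩, h2⟩, h3⟩
    · ext x; simp only [mem_inter_iff, mem_Ico, Set.mem_sdiff, mem_Iio, not_lt]
      constructor
      · rintro ⟨⟨⟨-, h1⟩, h2⟩, h3⟩; exact ⟨⟨h3, h1⟩, h2⟩
      · rintro ⟨⟨h3, h1⟩, h2⟩; exact ⟨⟨⟨ha.le.trans h3, h1⟩, h2⟩, h3⟩
  have f0 : volume (Ico 0 a ∩ B) ≠ ⊤ :=
    ((measure_mono inter_subset_left).trans_lt (by simp)).ne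
  have f1 : volume (Ico a 1 ∩ B) ≠ ⊤ :=
    ((measure_mono inter_subset_left).trans_lt (by simp)).ne
  obtain ⟨m0, h0⟩ : ∃ m : ℝ, m = (volume (Ico 0 a ∩ B)).toReal := ⟨_, rfl⟩
  obtain ⟨m1, h1⟩ : ∃ m : ℝ, m = (volume (Ico a 1 ∩ B)).toReal := ⟨_, rfl⟩
  have n0 : 0 ≤ m0 := h0 ▸ ENNReal.toReal_nonneg
  have n1 : 0 ≤ m1 := h1 ▸ ENNReal.toReal_nonneg
  have w0 : volume (Ico 0 a ∩ B) = ENNReal.ofReal m0 := by rw [h0, ENNReal.ofReal_toReal f0]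
  have w1 : volume (Ico a 1 ∩ B) = ENNReal.ofReal m1 := by rw [h1, ENNReal.ofReal_toReal f1]
  have hsum : volume (Ico (0 : ℝ) 1 ∩ B) = ENNReal.ofReal (m0 + m1) := by
    rw [split, w0, w1, ENNReal.ofReal_add n0 n1]
  by_cases h : a⁻¹ * m0 ≤ m0 + m1
  · refine ⟨false, ?_⟩
    rw [v0, w0, hsum, ← ENNReal.ofReal_mul (inv_nonneg.2 ha.le)]
    exact ENNReal.ofReal_le_ofReal h
  · refine ⟨true, ?_⟩
    rw [v1, w1, hsum, ← ENNReal.ofReal_mul (inv_nonneg.2 h1a.le)]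
    refine ENNReal.ofReal_le_ofReal ?_
    rw [inv_mul_le_iff₀ h1a]
    rw [inv_mul_le_iff₀ ha] at h
    nlinarith

/-- Gives a single word usable for both base points at once: only a small set of starting points is
carried into the bad set `B`. -/
theorem exists_volume_preimage_branchComp_le {a : ℝ} (ha : 0 < a) (ha1 : a < 1) (n : ℕ)
    (B : Set ℝ) : ∃ l : List Bool, l.length = n ∧
      volume (Ico (0 : ℝ) 1 ∩ branchComp a l ⁻¹' B) ≤ volume (Ico (0 : ℝ) 1 ∩ B) := by
  induction n generalizing B with
  | zero => exact ⟨[], rfl, le_rfl⟩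
  | succ n ih =>
    obtain ⟨b, hb⟩ := exists_volume_preimage_branch_le ha ha1 B
    obtain ⟨l, hl, hle⟩ := ih (branch a b ⁻¹' B)
    exact ⟨b :: l, by rw [List.length_cons, hl], hle.trans hb⟩

/-! ### Cross ratios of points in nearby fibres -/

/-- The cross ratio `(y₄ - y₁) (y₃ - y₂) / ((y₃ - y₁) (y₄ - y₂))`. -/
noncomputable def crossRatio (y₁ y₂ y₃ y₄ : ℝ) : ℝ :=
  (y₄ - y₁) * (y₃ - y₂) / ((y₃ - y₁) * (y₄ - y₂))

theorem crossRatio_nonneg {y₁ y₂ y₃ y₄ : ℝ} (h12 : y₁ ≤ y₂) (h23 : y₂ < y₃) (h34 : y₃ ≤ y₄) :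
    0 ≤ crossRatio y₁ y₂ y₃ y₄ := by
  unfold crossRatio
  apply div_nonneg <;> apply mul_nonneg <;> linarith

/-- Cross ratios are almost increased if the two intervals are mapped by nearby maps. -/
theorem crossRatio_perturb {g k : ℝ → ℝ} (hg : ContDiff ℝ 3 g) (hpos : ∀ y, 0 < deriv g y)
    (hS : ∀ y, schwarzian g y < 0) {y₁ y₂ y₃ y₄ η ε : ℝ} (h12 : y₁ ≤ y₂) (h23 : y₂ < y₃)
    (h34 : y₃ ≤ y₄) (h3 : |k y₃ - g y₃| ≤ η) (h4 : |k y₄ - g y₄| ≤ η) (hε0 : 0 ≤ ε)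
    (hε1 : 4 * ε ≤ 1) (hη : η ≤ ε * (g y₃ - g y₂)) :
    (1 - 4 * ε) * crossRatio y₁ y₂ y₃ y₄ ≤ crossRatio (g y₁) (g y₂) (k y₃) (k y₄) := by
  have hmono := strictMono_of_deriv_pos hpos
  have m12 := hmono.monotone h12
  have m23 := hmono h23
  have m34 := hmono.monotone h34
  have key := cross_ratio_le hg hpos hS h12 h23 h34
  obtain ⟨h3l, h3u⟩ := abs_le.1 h3
  obtain ⟨h4l, h4u⟩ := abs_le.1 h4
  have m23' : 0 < g y₃ - g y₂ := sub_pos.2 m23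
  -- All four intervals of the cross ratio contain `[g y₂, g y₃]`, so moving one endpoint by `η`
  -- changes each length by a relative factor of at most `1 ± ε`.
  have b14 : (1 - ε) * (g y₄ - g y₁) ≤ k y₄ - g y₁ := by nlinarith
  have b23 : (1 - ε) * (g y₃ - g y₂) ≤ k y₃ - g y₂ := by nlinarith
  have b13 : k y₃ - g y₁ ≤ (1 + ε) * (g y₃ - g y₁) := by nlinarith
  have b24 : k y₄ - g y₂ ≤ (1 + ε) * (g y₄ - g y₂) := by nlinarith
  have p13 : 0 < k y₃ - g y₁ := by nlinarith
  have p24 : 0 < k y₄ - g y₂ := by nlinarith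
  unfold crossRatio
  rw [← mul_div_assoc, div_le_div_iff₀ (by apply mul_pos <;> linarith) (mul_pos p13 p24)]
  set c1 := (y₄ - y₁) * (y₃ - y₂) with hc1
  set c2 := (y₃ - y₁) * (y₄ - y₂) with hc2
  have c1n : 0 ≤ c1 := by rw [hc1]; apply mul_nonneg <;> linarith
  have c2n : 0 ≤ c2 := by rw [hc2]; apply mul_nonneg <;> linarith
  set m1 := (g y₃ - g y₁) * (g y₄ - g y₂) with hm1
  set m2 := (g y₄ - g y₁) * (g y₃ - g y₂) with hm2
  have m1n : 0 ≤ m1 := by rw [hm1]; apply mul_nonneg <;> linarith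
  have u1 : (k y₃ - g y₁) * (k y₄ - g y₂) ≤ (1 + ε) ^ 2 * m1 := by
    refine (mul_le_mul b13 b24 p24.le (by apply mul_nonneg <;> linarith)).trans_eq ?_
    rw [hm1]; ring
  have u2 : (1 - ε) ^ 2 * m2 ≤ (k y₄ - g y₁) * (k y₃ - g y₂) := by
    refine le_trans (le_of_eq ?_) (mul_le_mul b14 b23 (by apply mul_nonneg <;> linarith)
      (le_trans (by apply mul_nonneg <;> linarith) b14))
    rw [hm2]; ring
  have hcoef : (1 - 4 * ε) * (1 + ε) ^ 2 ≤ (1 - ε) ^ 2 := by 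
    nlinarith [pow_nonneg hε0 3, pow_nonneg hε0 2]
  calc (1 - 4 * ε) * c1 * ((k y₃ - g y₁) * (k y₄ - g y₂))
      ≤ (1 - 4 * ε) * c1 * ((1 + ε) ^ 2 * m1) :=
        mul_le_mul_of_nonneg_left u1 (mul_nonneg (by linarith) c1n)
    _ = (1 - 4 * ε) * (1 + ε) ^ 2 * (m1 * c1) := by ring
    _ ≤ (1 - ε) ^ 2 * (m1 * c1) := mul_le_mul_of_nonneg_right hcoef (mul_nonneg m1n c1n)
    _ ≤ (1 - ε) ^ 2 * (m2 * c2) := mul_le_mul_of_nonneg_left key (sq_nonneg _)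
    _ = (1 - ε) ^ 2 * m2 * c2 := by ring
    _ ≤ (k y₄ - g y₁) * (k y₃ - g y₂) * c2 := mul_le_mul_of_nonneg_right u2 c2n

/-- One step of the induction along a word. Here `h` is the base distance, `σ` the slope of the
branch and `A * h` the discrepancy of the two fibre maps. Taking `L` large sacrifices only part of
the expansion, from `c` to `lam`, so `h / gap` contracts by `1 / lam`. The correction `1 - K * (h /
gap)` then recovers more than the relative loss `4 * (A / κ) * (h / gap)` in the cross ratio, so
their product cannot decrease. -/
theorem crossRatio_step {g k : ℝ → ℝ} (hg : ContDiff ℝ 3 g) (hpos : ∀ y, 0 < deriv g y)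
    (hS : ∀ y, schwarzian g y < 0) {y₁ y₂ y₃ y₄ h A c σ κ lam K L : ℝ} (h12 : y₁ ≤ y₂)
    (h23 : y₂ < y₃) (h34 : y₃ ≤ y₄) (hh : 0 ≤ h) (hκ : 0 < κ) (hκσ : κ ≤ σ) (hlam : 1 < lam)
    (hA : 0 ≤ A) (hL : A ≤ (c - lam) * κ * L) (hK : 4 * (A / κ) ≤ K * (1 - 1 / lam))
    (hK0 : 0 ≤ K) (hKL : K ≤ L) (hL0 : 0 < L) (hD : c * σ * (y₃ - y₂) ≤ g y₃ - g y₂)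
    (h3 : |k y₃ - g y₃| ≤ A * h) (h4 : |k y₄ - g y₄| ≤ A * h) (hLh : L * h ≤ y₃ - y₂) :
    lam * (σ * (y₃ - y₂)) ≤ k y₃ - g y₂ ∧
    crossRatio y₁ y₂ y₃ y₄ * (1 - K * (h / (y₃ - y₂))) ≤
      crossRatio (g y₁) (g y₂) (k y₃) (k y₄) * (1 - K * (σ * h / (k y₃ - g y₂))) := by
  have hmono := strictMono_of_deriv_pos hpos
  have d0 : 0 < y₃ - y₂ := sub_pos.2 h23
  have hσ : 0 < σ := hκ.trans_le hκσ
  have hcl : 0 ≤ c - lam := by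
    by_contra hc
    have h2 : (c - lam) * κ * L < 0 :=
      mul_neg_of_neg_of_pos (mul_neg_of_neg_of_pos (not_le.1 hc) hκ) hL0
    linarith
  have hAh : A * h ≤ (c - lam) * σ * (y₃ - y₂) := by
    calc A * h ≤ (c - lam) * κ * L * h := mul_le_mul_of_nonneg_right hL hh
      _ = (c - lam) * κ * (L * h) := by ring
      _ ≤ (c - lam) * σ * (y₃ - y₂) := by
        apply mul_le_mul _ hLh (mul_nonneg hL0.le hh) (mul_nonneg hcl hσ.le)
        exact mul_le_mul_of_nonneg_left hκσ hcl
  have hgap : lam * (σ * (y₃ - y₂)) ≤ k y₃ - g y₂ := by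
    have := (abs_le.1 h3).1
    linarith
  refine ⟨hgap, ?_⟩
  set r := h / (y₃ - y₂) with hr
  have hr0 : 0 ≤ r := div_nonneg hh d0.le
  have hLr : L * r ≤ 1 := by rw [hr, ← mul_div_assoc, div_le_one d0]; exact hLh
  have hKr : K * r ≤ 1 := (mul_le_mul_of_nonneg_right hKL hr0).trans hLr
  have hlam0 : 0 < lam := one_pos.trans hlam
  have hil : 0 < 1 / lam := by positivity
  have hil1 : 1 / lam < 1 := by rw [div_lt_one hlam0]; exact hlam
  have hAκ : 0 ≤ A / κ := div_nonneg hA hκ.le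
  have hhr : h = r * (y₃ - y₂) := by rw [hr]; field_simp
  have hm23 : κ * (y₃ - y₂) ≤ g y₃ - g y₂ := by
    refine le_trans ?_ hD
    have : κ ≤ c * σ := hκσ.trans (le_mul_of_one_le_left hσ.le (by linarith))
    exact mul_le_mul_of_nonneg_right this d0.le
  have hKr0 : 0 ≤ K * r := mul_nonneg hK0 hr0
  have hsmall : 4 * (A / κ * r) ≤ K * r * (1 - 1 / lam) := by
    have := mul_le_mul_of_nonneg_right hK hr0
    linarith
  have hQ0 : 0 ≤ 1 / lam * (K * r) := mul_nonneg hil.le hKr0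
  have hsmall' : 4 * (A / κ * r) ≤ K * r - 1 / lam * (K * r) := by linarith
  have hpert := crossRatio_perturb hg hpos hS (ε := A / κ * r) h12 h23 h34 h3 h4
    (mul_nonneg hAκ hr0) (by linarith)
    (by
      calc A * h = A / κ * r * (κ * (y₃ - y₂)) := by rw [hhr]; field_simp
        _ ≤ A / κ * r * (g y₃ - g y₂) :=
          mul_le_mul_of_nonneg_left hm23 (mul_nonneg hAκ hr0))
  have hr' : σ * h / (k y₃ - g y₂) ≤ 1 / lam * r := by
    rw [div_le_iff₀ (lt_of_lt_of_le (by positivity) hgap)]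
    calc σ * h = 1 / lam * r * (lam * (σ * (y₃ - y₂))) := by rw [hhr]; field_simp
      _ ≤ 1 / lam * r * (k y₃ - g y₂) :=
        mul_le_mul_of_nonneg_left hgap (mul_nonneg hil.le hr0)
  have hKr' : K * (σ * h / (k y₃ - g y₂)) ≤ 1 / lam * (K * r) := by
    refine (mul_le_mul_of_nonneg_left hr' hK0).trans_eq (by ring)
  have hE0 := crossRatio_nonneg h12 h23 h34
  have hkr1 : 0 ≤ 1 - 1 / lam * (K * r) := by linarith [mul_nonneg hAκ hr0]
  have hEE0 : 0 ≤ crossRatio (g y₁) (g y₂) (k y₃) (k y₄) := by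
    refine le_trans (mul_nonneg ?_ hE0) hpert
    linarith
  calc crossRatio y₁ y₂ y₃ y₄ * (1 - K * r)
      ≤ crossRatio y₁ y₂ y₃ y₄ * ((1 - 4 * (A / κ * r)) * (1 - 1 / lam * (K * r))) := by
        refine mul_le_mul_of_nonneg_left ?_ hE0
        have := mul_nonneg (mul_nonneg hAκ hr0) hQ0
        linarith
    _ = (1 - 4 * (A / κ * r)) * crossRatio y₁ y₂ y₃ y₄ * (1 - 1 / lam * (K * r)) := by ring
    _ ≤ crossRatio (g y₁) (g y₂) (k y₃) (k y₄) * (1 - 1 / lam * (K * r)) :=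
        mul_le_mul_of_nonneg_right hpert hkr1
    _ ≤ _ := mul_le_mul_of_nonneg_left (by linarith) hEE0

/-! ### Lipschitz continuity on the pinched set -/

/-- The data of the skew product in the stable coordinate, lifted to the real line: fibre maps `F x`
and two invariant graphs `q ≤ p`. -/
structure LiftedSystem (a c A s t : ℝ) (F : ℝ → ℝ → ℝ) (p q : ℝ → ℝ) : Prop where
  a_pos : 0 < a
  a_lt_one : a < 1
  one_lt : 1 < c
  A_nonneg : 0 ≤ A
  smooth : ∀ x, ContDiff ℝ 3 (F x)
  deriv_pos : ∀ x y, 0 < deriv (F x) y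
  schwarzian_neg : ∀ x y, schwarzian (F x) y < 0
  lipschitz : ∀ x ∈ Icc (0 : ℝ) 1, ∀ x' ∈ Icc (0 : ℝ) 1, ∀ y ∈ Icc s t,
    |F x y - F x' y| ≤ A * |x - x'|
  expand : ∀ b, ∀ x ∈ Icc (0 : ℝ) 1, ∀ y ∈ Icc s t, ∀ y' ∈ Icc s t, y ≤ y' →
    c * branchSlope a b * (y' - y) ≤ F x y' - F x y
  p_mem : ∀ x, p x ∈ Icc s t
  q_mem : ∀ x, q x ∈ Icc s t
  q_le_p : ∀ x, q x ≤ p x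
  p_branch : ∀ b, ∀ x ∈ Icc (0 : ℝ) 1, p (branch a b x) = F x (p x)
  q_branch : ∀ b, ∀ x ∈ Icc (0 : ℝ) 1, q (branch a b x) = F x (q x)

section Core

variable {a c A s t : ℝ} {F : ℝ → ℝ → ℝ} {p q : ℝ → ℝ}

theorem LiftedSystem.crossRatio_branchComp (H : LiftedSystem a c A s t F p q)
    {κ lam K L : ℝ} (hκ : 0 < κ) (hκσ : ∀ b, κ ≤ branchSlope a b) (hlam : 1 < lam)
    (hL : A ≤ (c - lam) * κ * L) (hK : 4 * (A / κ) ≤ K * (1 - 1 / lam))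
    (hK0 : 0 ≤ K) (hKL : K ≤ L) (hL0 : 0 < L) {u v : ℝ} (hu : u ∈ Icc (0 : ℝ) 1)
    (hv : v ∈ Icc (0 : ℝ) 1) (hgap : 0 < q v - p u) (hLgap : L * |u - v| ≤ q v - p u)
    (l : List Bool) :
    0 < q (branchComp a l v) - p (branchComp a l u) ∧
    L * |branchComp a l u - branchComp a l v| ≤
      q (branchComp a l v) - p (branchComp a l u) ∧
    crossRatio (q u) (p u) (q v) (p v) * (1 - K * (|u - v| / (q v - p u))) ≤
      crossRatio (q (branchComp a l u)) (p (branchComp a l u)) (q (branchComp a l v))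
        (p (branchComp a l v)) * (1 - K * (|branchComp a l u - branchComp a l v| /
          (q (branchComp a l v) - p (branchComp a l u)))) := by
  induction l with
  | nil => exact ⟨hgap, hLgap, le_rfl⟩
  | cons b l ih =>
    obtain ⟨i1, i2, i3⟩ := ih
    have hu' := branchComp_mem H.a_pos H.a_lt_one l hu
    have hv' := branchComp_mem H.a_pos H.a_lt_one l hv
    simp only [branchComp]
    generalize branchComp a l u = u' at *
    generalize branchComp a l v = v' at *
    have hσ := branchSlope_pos H.a_pos H.a_lt_one b
    have hcl := H.lipschitz v' hv' u' hu'
    rw [abs_sub_comm v' u'] at hcl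
    obtain ⟨s1, s2⟩ := crossRatio_step (H.smooth u') (H.deriv_pos u') (H.schwarzian_neg u')
      (k := F v') (H.q_le_p u') (sub_pos.1 i1) (H.q_le_p v') (abs_nonneg (u' - v')) hκ (hκσ b)
      hlam H.A_nonneg hL hK hK0 hKL hL0
      (H.expand b u' hu' _ (H.p_mem u') _ (H.q_mem v') (sub_pos.1 i1).le)
      (hcl _ (H.q_mem v')) (hcl _ (H.p_mem v')) i2
    rw [H.p_branch b u' hu', H.p_branch b v' hv', H.q_branch b u' hu', H.q_branch b v' hv',
      branch_sub, abs_mul, abs_of_pos hσ]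
    have hpos : 0 < branchSlope a b * (q v' - p u') := mul_pos hσ i1
    refine ⟨lt_of_lt_of_le (mul_pos (one_pos.trans hlam) hpos) s1, ?_, i3.trans s2⟩
    calc L * (branchSlope a b * |u' - v'|) = branchSlope a b * (L * |u' - v'|) := by ring
      _ ≤ branchSlope a b * (q v' - p u') := mul_le_mul_of_nonneg_left i2 hσ.le
      _ ≤ lam * (branchSlope a b * (q v' - p u')) := le_mul_of_one_le_left hpos.le hlam.le
      _ ≤ _ := s1

/-- There is a constant `L` such that cross ratios of pairs of fibres are bounded below along every
word as long as the initial gap is at least `L` times the initial distance. -/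
theorem LiftedSystem.exists_crossRatio_bound (H : LiftedSystem a c A s t F p q) :
    ∃ L : ℝ, 0 < L ∧ ∀ u ∈ Icc (0 : ℝ) 1, ∀ v ∈ Icc (0 : ℝ) 1, 0 < q v - p u →
      L * |u - v| ≤ q v - p u → ∀ l : List Bool,
      0 < q (branchComp a l v) - p (branchComp a l u) ∧
      crossRatio (q u) (p u) (q v) (p v) / 2 ≤
        crossRatio (q (branchComp a l u)) (p (branchComp a l u)) (q (branchComp a l v))
          (p (branchComp a l v)) := by
  have ha := H.a_pos
  have ha1 := H.a_lt_one
  have hc := H.one_lt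
  have hA := H.A_nonneg
  set κ := min a (1 - a) with hκd
  have hκ : 0 < κ := lt_min ha (sub_pos.2 ha1)
  set lam := (1 + c) / 2 with hlamd
  have hlam : 1 < lam := by rw [hlamd]; linarith
  have hcl : 0 < c - lam := by rw [hlamd]; linarith
  have hil : 0 < 1 - 1 / lam := by
    rw [sub_pos, div_lt_one (one_pos.trans hlam)]; exact hlam
  set K := 4 * (A / κ) / (1 - 1 / lam) with hKd
  have hK0 : 0 ≤ K := by positivity
  -- The summand `2 * K` keeps the initial correction factor at least `1/2`; the second summand lets
  -- the fibre discrepancy be absorbed in the margin `c - lam`; the `1` ensures positivity.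
  set L := 2 * K + A / ((c - lam) * κ) + 1 with hLd
  have hQ : 0 ≤ A / ((c - lam) * κ) := by positivity
  have hL0 : 0 < L := by rw [hLd]; positivity
  have hL : A ≤ (c - lam) * κ * L := by
    have h1 : A / ((c - lam) * κ) ≤ L := by rw [hLd]; linarith
    rwa [div_le_iff₀' (mul_pos hcl hκ)] at h1
  refine ⟨L, hL0, fun u hu v hv hgap hLgap l => ?_⟩
  obtain ⟨h1, -, h3⟩ := H.crossRatio_branchComp hκ (min_le_branchSlope a) hlam hL
    (by rw [hKd, div_mul_cancel₀ _ hil.ne']) hK0 (by rw [hLd]; linarith) hL0 hu hv hgap hLgap l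
  refine ⟨h1, ?_⟩
  have e0 := crossRatio_nonneg (H.q_le_p u) (sub_pos.1 hgap) (H.q_le_p v)
  have e1 := crossRatio_nonneg (H.q_le_p (branchComp a l u)) (sub_pos.1 h1)
    (H.q_le_p (branchComp a l v))
  have r0 : 0 ≤ |u - v| / (q v - p u) := div_nonneg (abs_nonneg _) hgap.le
  have r1 : 0 ≤ |branchComp a l u - branchComp a l v| /
      (q (branchComp a l v) - p (branchComp a l u)) := div_nonneg (abs_nonneg _) h1.le
  have hr : L * (|u - v| / (q v - p u)) ≤ 1 := by
    rw [← mul_div_assoc, div_le_one hgap]; exact hLgap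
  have hKr : 2 * K * (|u - v| / (q v - p u)) ≤ 1 :=
    (mul_le_mul_of_nonneg_right (by rw [hLd]; linarith) r0).trans hr
  calc _ = crossRatio (q u) (p u) (q v) (p v) * (1 / 2) := by ring
    _ ≤ crossRatio (q u) (p u) (q v) (p v) * (1 - K * (|u - v| / (q v - p u))) :=
      mul_le_mul_of_nonneg_left (by linarith) e0
    _ ≤ _ := h3
    _ ≤ _ := mul_le_of_le_one_right e1 (by linarith [mul_nonneg hK0 r1])

/-- A lower bound for the gap from a lower bound for the cross ratio. -/
theorem le_gap_of_le_crossRatio {e δ W y₁ y₂ y₃ y₄ : ℝ} (he : 0 ≤ e) (hδ : 0 < δ)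
    (h12 : δ ≤ y₂ - y₁) (h23 : y₂ < y₃) (h34 : δ ≤ y₄ - y₃) (hW : y₄ - y₁ ≤ W)
    (hE : e ≤ crossRatio y₁ y₂ y₃ y₄) : e * δ ^ 2 / W ≤ y₃ - y₂ := by
  have h14 : 0 < y₄ - y₁ := by linarith
  have hW0 : 0 < W := h14.trans_le hW
  unfold crossRatio at hE
  rw [le_div_iff₀ (by apply mul_pos <;> linarith)] at hE
  rw [div_le_iff₀ hW0]
  have h1 : δ ^ 2 ≤ (y₃ - y₁) * (y₄ - y₂) := by
    rw [sq]
    exact mul_le_mul (by linarith) (by linarith) hδ.le (by linarith)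
  calc e * δ ^ 2 ≤ e * ((y₃ - y₁) * (y₄ - y₂)) := mul_le_mul_of_nonneg_left h1 he
    _ ≤ (y₄ - y₁) * (y₃ - y₂) := hE
    _ ≤ W * (y₃ - y₂) := mul_le_mul_of_nonneg_right hW (by linarith)
    _ = _ := by ring

theorem sq_div_le_crossRatio {g₀ W y₁ y₂ y₃ y₄ : ℝ} (hg : 0 < g₀) (h12 : y₁ ≤ y₂)
    (h23 : g₀ ≤ y₃ - y₂) (h34 : y₃ ≤ y₄) (hW : y₄ - y₁ ≤ W) :
    g₀ ^ 2 / W ^ 2 ≤ crossRatio y₁ y₂ y₃ y₄ := by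
  have hW0 : 0 < W := by linarith
  unfold crossRatio
  rw [div_le_div_iff₀ (by positivity) (by apply mul_pos <;> linarith)]
  apply mul_le_mul
  · rw [sq]
    exact mul_le_mul (by linarith) h23 hg.le (by linarith)
  · rw [sq]
    exact mul_le_mul (by linarith) (by linarith) (by linarith) hW0.le
  · apply mul_nonneg <;> linarith
  · apply mul_nonneg <;> linarith

/-- Continuity from above: the sets of short fibres decrease to the pinched set, which is null. -/
theorem exists_volume_gap_lt (hp : Measurable p) (hq : Measurable q) (hqp : ∀ x, q x ≤ p x)
    (hnull : volume (Ico (0 : ℝ) 1 ∩ {x | p x = q x}) = 0) {ρ : ENNReal} (hρ : 0 < ρ) :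
    ∃ δ : ℝ, 0 < δ ∧ volume (Ico (0 : ℝ) 1 ∩ {x | p x - q x < δ}) < ρ := by
  have hδ0 : Tendsto (fun n : ℕ => 1 / ((n : ℝ) + 1)) atTop (𝓝 0) :=
    tendsto_one_div_add_atTop_nhds_zero_nat
  have hinter : ⋂ n : ℕ, Ico (0 : ℝ) 1 ∩ {x | p x - q x < 1 / ((n : ℝ) + 1)} =
      Ico (0 : ℝ) 1 ∩ {x | p x = q x} := by
    ext x
    simp only [mem_iInter, mem_inter_iff, mem_ofPred_eq]
    constructor
    · intro h
      refine ⟨(h 0).1, le_antisymm ?_ (hqp x)⟩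
      have := ge_of_tendsto' hδ0 fun n => (h n).2.le
      linarith
    · rintro ⟨h1, h2⟩ n
      refine ⟨h1, ?_⟩
      rw [h2, sub_self]; positivity
  have hlim := tendsto_measure_iInter_atTop (μ := volume)
    (s := fun n : ℕ => Ico (0 : ℝ) 1 ∩ {x | p x - q x < 1 / ((n : ℝ) + 1)})
    (fun n => (measurableSet_Ico.inter
      (measurableSet_lt (hp.sub hq) measurable_const)).nullMeasurableSet)
    (fun m n hmn => inter_subset_inter_right _ fun x hx =>
      lt_of_lt_of_le (show p x - q x < 1 / ((n : ℝ) + 1) from hx)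
        (one_div_le_one_div_of_le (by positivity) (by exact_mod_cast Nat.succ_le_succ hmn)))
    ⟨0, ((measure_mono inter_subset_left).trans_lt (by simp)).ne⟩
  rw [hinter, hnull] at hlim
  obtain ⟨n, hn⟩ := (hlim.eventually_lt_const hρ).exists
  exact ⟨1 / ((n : ℝ) + 1), by positivity, hn⟩

/-- Off a small set, `p` is uniformly close to one continuous function. The sets where the
approximation is still bad decrease to the empty set. -/
theorem exists_volume_approx_lt {P : ℕ → ℝ → ℝ} (hP : ∀ n, Continuous (P n)) (hp : Measurable p)
    (hanti : ∀ x, Antitone fun n => P n x) (hlimP : ∀ x, Tendsto (fun n => P n x) atTop (𝓝 (p x)))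
    {ε : ℝ} (hε : 0 < ε) {ρ : ENNReal} (hρ : 0 < ρ) :
    ∃ N, volume (Ico (0 : ℝ) 1 ∩ {x | ε ≤ P N x - p x}) < ρ := by
  have hinter : ⋂ n : ℕ, Ico (0 : ℝ) 1 ∩ {x | ε ≤ P n x - p x} = ∅ := by
    refine eq_empty_of_forall_notMem fun x hx => ?_
    simp only [mem_iInter, mem_inter_iff, mem_ofPred_eq] at hx
    have := ge_of_tendsto' ((hlimP x).sub_const (p x)) fun n => (hx n).2
    linarith
  have hlim := tendsto_measure_iInter_atTop (μ := volume)
    (s := fun n : ℕ => Ico (0 : ℝ) 1 ∩ {x | ε ≤ P n x - p x})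
    (fun n => (measurableSet_Ico.inter
      (measurableSet_le measurable_const ((hP n).measurable.sub hp))).nullMeasurableSet)
    (fun m n hmn => inter_subset_inter_right _ fun x (hx : ε ≤ _) =>
      hx.trans (sub_le_sub_right (hanti x hmn) _))
    ⟨0, ((measure_mono inter_subset_left).trans_lt (by simp)).ne⟩
  rw [hinter, measure_empty] at hlim
  exact (hlim.eventually_lt_const hρ).exists

theorem exists_mem_ball_notMem {B : Set ℝ} {x ρ : ℝ}
    (hρ : Metric.ball x ρ ⊆ Ico (0 : ℝ) 1)
    (hB : volume (Ico (0 : ℝ) 1 ∩ B) < ENNReal.ofReal (2 * ρ)) :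
    ∃ u ∈ Metric.ball x ρ, u ∉ B := by
  by_contra! h
  have : Metric.ball x ρ ⊆ Ico (0 : ℝ) 1 ∩ B := fun u hu => ⟨hρ hu, h u hu⟩
  have h2 := (measure_mono this).trans_lt hB
  rw [Real.volume_ball] at h2
  exact lt_irrefl _ h2

/-- If the pinched set is a null set, then the invariant graph over the pinched set is Lipschitz. -/
theorem LiftedSystem.exists_lipschitz (H : LiftedSystem a c A s t F p q) {P : ℕ → ℝ → ℝ}
    (hP : ∀ n, Continuous (P n)) (hanti : ∀ x, Antitone fun n => P n x)
    (hlimP : ∀ x, Tendsto (fun n => P n x) atTop (𝓝 (p x))) (hp : Measurable p)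
    (hq : Measurable q) (hnull : volume (Ico (0 : ℝ) 1 ∩ {x | p x = q x}) = 0) :
    ∃ L : ℝ, 0 < L ∧ ∀ x ∈ Ioo (0 : ℝ) 1, ∀ x' ∈ Ioo (0 : ℝ) 1, ContinuousAt p x →
      ContinuousAt q x' → q x' - p x ≤ L * |x - x'| := by
  obtain ⟨L, hL0, hL⟩ := H.exists_crossRatio_bound
  refine ⟨L, hL0, fun x hx x' hx' hpx hqx => ?_⟩
  by_contra! hlt
  have hgap0 : 0 < q x' - p x := (mul_nonneg hL0.le (abs_nonneg _)).trans_lt hlt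
  set g₀ := (q x' - p x) / 2 with hg₀
  have hg0 : 0 < g₀ := half_pos hgap0
  obtain ⟨ρ, hρ, hball⟩ : ∃ ρ > 0, ∀ u ∈ Metric.ball x ρ, ∀ v ∈ Metric.ball x' ρ,
      u ∈ Ioo (0 : ℝ) 1 ∧ v ∈ Ioo (0 : ℝ) 1 ∧ L * |u - v| ≤ q v - p u ∧ g₀ ≤ q v - p u := by
    have hpc : ContinuousAt (fun z : ℝ × ℝ => p z.1) (x, x') :=
      ContinuousAt.comp (f := Prod.fst) hpx continuousAt_fst
    have hqc : ContinuousAt (fun z : ℝ × ℝ => q z.2) (x, x') :=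
      ContinuousAt.comp (f := Prod.snd) hqx continuousAt_snd
    have hdc : ContinuousAt (fun z : ℝ × ℝ => L * |z.1 - z.2|) (x, x') := by fun_prop
    have e1 := hdc.eventually_lt (hqc.sub hpc) hlt
    have e2 : ∀ᶠ z : ℝ × ℝ in 𝓝 (x, x'), g₀ < q z.2 - p z.1 :=
      (hqc.sub hpc).eventually_const_lt (by rw [hg₀]; exact half_lt_self hgap0)
    have e3 : ∀ᶠ z : ℝ × ℝ in 𝓝 (x, x'), z.1 ∈ Ioo (0 : ℝ) 1 :=
      continuousAt_fst.eventually (isOpen_Ioo.mem_nhds hx)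
    have e4 : ∀ᶠ z : ℝ × ℝ in 𝓝 (x, x'), z.2 ∈ Ioo (0 : ℝ) 1 :=
      continuousAt_snd.eventually (isOpen_Ioo.mem_nhds hx')
    obtain ⟨ρ, hρ, h⟩ := Metric.eventually_nhds_iff_ball.1 (e1.and (e2.and (e3.and e4)))
    refine ⟨ρ, hρ, fun u hu v hv => ?_⟩
    obtain ⟨h1, h2, h3, h4⟩ := h (u, v) (by rw [← ball_prod_same]; exact ⟨hu, hv⟩)
    exact ⟨h3, h4, h1.le, h2.le⟩
  have hsub : Metric.ball x ρ ⊆ Ico (0 : ℝ) 1 := fun u hu =>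
    Ioo_subset_Ico_self (hball u hu x' (Metric.mem_ball_self hρ)).1
  have hsub' : Metric.ball x' ρ ⊆ Ico (0 : ℝ) 1 := fun v hv =>
    Ioo_subset_Ico_self (hball x (Metric.mem_ball_self hρ) v hv).2.1
  set W := t - s with hWd
  have hdist : ∀ u v, p v - q u ≤ W := fun u v => by
    have := (H.p_mem v).2
    have := (H.q_mem u).1
    rw [hWd]; linarith
  have hW : 0 < W := by
    have := hdist x x'
    have := H.q_le_p x
    have := H.q_le_p x'
    linarith
  have hρ' : (0 : ENNReal) < ENNReal.ofReal ρ := ENNReal.ofReal_pos.2 hρ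
  -- The order of choices matters: the fibre length `δ` fixes the forced final gap `ε`, which fixes
  -- the approximation `P N`; its modulus of continuity `ω` fixes the word length `n`.
  obtain ⟨δ, hδ, hvδ⟩ := exists_volume_gap_lt hp hq H.q_le_p hnull hρ'
  set e₀ := g₀ ^ 2 / W ^ 2 / 2 with he₀
  have he0 : 0 < e₀ := by positivity
  set ε := e₀ * δ ^ 2 / W with hεd
  have hε : 0 < ε := by positivity
  obtain ⟨N, hN⟩ := exists_volume_approx_lt hP hp hanti hlimP (half_pos hε) hρ'
  have huc := isCompact_Icc.uniformContinuousOn_of_continuous (s := Icc (0 : ℝ) 1)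
    (hP N).continuousOn
  obtain ⟨ω, hω, hωP⟩ := Metric.uniformContinuousOn_iff.1 huc (ε / 2) (half_pos hε)
  have hγ : max a (1 - a) < 1 := max_lt H.a_lt_one (by linarith [H.a_pos])
  obtain ⟨n, hn⟩ := exists_pow_lt_of_lt_one hω hγ
  set B := {x | p x - q x < δ} ∪ {x | ε / 2 ≤ P N x - p x} with hB
  -- Each half of the bad set has volume below `ρ`, while the balls around `x` and `x'` have volume
  -- `2 * ρ`; so each ball contains a point that the word carries outside `B`.
  have hvB : volume (Ico (0 : ℝ) 1 ∩ B) < ENNReal.ofReal (2 * ρ) := by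
    rw [hB, inter_union_distrib_left, two_mul, ENNReal.ofReal_add hρ.le hρ.le]
    exact (measure_union_le _ _).trans_lt (ENNReal.add_lt_add hvδ hN)
  obtain ⟨l, hl, hvl⟩ := exists_volume_preimage_branchComp_le H.a_pos H.a_lt_one n B
  obtain ⟨u, hu, huB⟩ := exists_mem_ball_notMem hsub (hvl.trans_lt hvB)
  obtain ⟨v, hv, hvB'⟩ := exists_mem_ball_notMem hsub' (hvl.trans_lt hvB)
  obtain ⟨hu1, hv1, hLg, hgg⟩ := hball u hu v hv
  have hu2 := Ioo_subset_Icc_self hu1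
  have hv2 := Ioo_subset_Icc_self hv1
  obtain ⟨hgl, hEl⟩ := hL u hu2 v hv2 (hg0.trans_le hgg) hLg l
  have hE0 := sq_div_le_crossRatio hg0 (H.q_le_p u) hgg (H.q_le_p v) (hdist u v)
  have hul := branchComp_mem H.a_pos H.a_lt_one l hu2
  have hvl' := branchComp_mem H.a_pos H.a_lt_one l hv2
  have hd : |branchComp a l v - branchComp a l u| < ω := by
    refine (abs_branchComp_sub_le H.a_pos H.a_lt_one l v u).trans_lt (lt_of_le_of_lt ?_ hn)
    rw [hl]
    refine mul_le_of_le_one_right (pow_nonneg (H.a_pos.le.trans (le_max_left _ _)) _) ?_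
    rw [abs_le]
    constructor <;> linarith [hu2.1, hu2.2, hv2.1, hv2.2]
  have hPuv := hωP _ hvl' _ hul (by rwa [Real.dist_eq])
  rw [Real.dist_eq] at hPuv
  simp only [hB, mem_preimage, mem_union, mem_ofPred_eq, not_or, not_lt, not_le] at huB hvB'
  have hgap := le_gap_of_le_crossRatio (e := e₀) he0.le hδ huB.1 (sub_pos.1 hgl) hvB'.1
    (hdist (branchComp a l u) (branchComp a l v)) (by rw [he₀]; linarith)
  -- With `u'`, `v'` the images under the word, `q v' ≤ p v' ≤ P N v' < P N u' + ε / 2 < p u' + ε`,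
  -- against the forced gap `q v' - p u' ≥ ε`.
  have h1 := (hanti (branchComp a l v)).le_of_tendsto (hlimP _) N
  have h2 := H.q_le_p (branchComp a l v)
  have h3 := (abs_lt.1 hPuv).2
  have h4 := huB.2
  simp only [← hεd] at hgap
  linarith

end Core

/-! ### Differentiability of Lipschitz invariant graphs -/

/-- Bounded solutions of a linear contracting cohomological equation over `x ↦ a x`. -/
theorem exists_bounded_solution {a U θ : ℝ} (ha : 0 < a) (ha1 : a < 1) (hθ1 : θ < 1)
    {u w : ℝ → ℝ} (hu : ∀ x ∈ Icc (0 : ℝ) 1, |u x| ≤ U)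
    (hw : ∀ x ∈ Icc (0 : ℝ) 1, |w x| ≤ θ) :
    ∃ X : ℝ → ℝ, (∀ x ∈ Icc (0 : ℝ) 1, X x = u x + w x * X (a * x)) ∧
      ∃ M, ∀ x ∈ Icc (0 : ℝ) 1, |X x| ≤ M := by
  have hmem : ∀ x ∈ Icc (0 : ℝ) 1, ∀ n : ℕ, a ^ n * x ∈ Icc (0 : ℝ) 1 := fun x hx n =>
    ⟨mul_nonneg (pow_nonneg ha.le n) hx.1,
      mul_le_one₀ (pow_le_one₀ ha.le ha1.le) hx.1 hx.2⟩
  have hθ0 : 0 ≤ θ := (abs_nonneg _).trans (hw 0 ⟨le_rfl, zero_le_one⟩)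
  have hU0 : 0 ≤ U := (abs_nonneg _).trans (hu 0 ⟨le_rfl, zero_le_one⟩)
  -- The terms of the series obtained by iterating the equation along `x, a x, a² x, …`, dominated
  -- by a geometric series.
  set T : ℝ → ℕ → ℝ := fun x n => u (a ^ n * x) * ∏ k ∈ Finset.range n, w (a ^ k * x) with hT
  have hbd : ∀ x ∈ Icc (0 : ℝ) 1, ∀ n, ‖T x n‖ ≤ U * θ ^ n := by
    intro x hx n
    rw [hT, Real.norm_eq_abs, abs_mul, Finset.abs_prod]
    refine mul_le_mul (hu _ (hmem x hx n)) ?_ (Finset.prod_nonneg fun _ _ => abs_nonneg _) hU0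
    calc ∏ k ∈ Finset.range n, |w (a ^ k * x)| ≤ ∏ _k ∈ Finset.range n, θ :=
          Finset.prod_le_prod (fun _ _ => abs_nonneg _) fun k _ => hw _ (hmem x hx k)
      _ = θ ^ n := by rw [Finset.prod_const, Finset.card_range]
  have hgeo : HasSum (fun n : ℕ => U * θ ^ n) (U * (1 - θ)⁻¹) :=
    (hasSum_geometric_of_lt_one hθ0 hθ1).mul_left U
  have hsum : ∀ x ∈ Icc (0 : ℝ) 1, Summable (T x) := fun x hx =>
    Summable.of_norm_bounded hgeo.summable (hbd x hx)
  refine ⟨fun x => ∑' n, T x n, fun x hx => ?_, U * (1 - θ)⁻¹, fun x hx =>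
    tsum_of_norm_bounded hgeo (hbd x hx)⟩
  simp only
  rw [(hsum x hx).tsum_eq_zero_add, ← tsum_mul_left]
  congr 1
  · simp [hT]
  · refine tsum_congr fun n => ?_
    simp only [hT, Finset.prod_range_succ', pow_zero, one_mul, pow_succ, mul_assoc]
    ring

/-- A quadratic bound for a linear function near a point of `[0, 1]` forces it to vanish. -/
theorem eq_zero_of_abs_mul_le {m C x : ℝ} (hx : x ∈ Icc (0 : ℝ) 1)
    (h : ∀ x' ∈ Icc (0 : ℝ) 1, |m * (x' - x)| ≤ C * (x' - x) ^ 2) : m = 0 := by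
  have key : ∀ ε : ℝ, 0 < ε → ε ≤ 1 / 2 → |m| ≤ C * ε := by
    intro ε h0 h1
    have h2 : |m| * ε ≤ C * ε ^ 2 := by
      rcases le_total x (1 / 2) with hx2 | hx2
      · have := h (x + ε) ⟨by linarith [hx.1], by linarith⟩
        rwa [add_sub_cancel_left, abs_mul, abs_of_pos h0] at this
      · have := h (x - ε) ⟨by linarith, by linarith [hx.2]⟩
        rwa [sub_sub_cancel_left, abs_mul, abs_neg, abs_of_pos h0, neg_sq] at this
    nlinarith
  have hlim : Tendsto (fun ε : ℝ => C * ε) (𝓝[>] 0) (𝓝 (C * 0)) :=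
    ((continuous_const.mul continuous_id).tendsto 0).mono_left nhdsWithin_le_nhds
  have := ge_of_tendsto hlim (by
    filter_upwards [Ioc_mem_nhdsGT (show (0 : ℝ) < 1 / 2 by norm_num)] with ε hε
    exact key ε hε.1 hε.2)
  rw [mul_zero] at this
  exact abs_eq_zero.1 (le_antisymm this (abs_nonneg m))

/-- Second order data of a family of fibre maps near `[0, 1] × [s, t]`. -/
structure SecondOrder (a c s t A₀ B : ℝ) (F A D : ℝ → ℝ → ℝ) : Prop where
  B_nonneg : 0 ≤ B
  bound : ∀ x ∈ Icc (0 : ℝ) 1, ∀ y ∈ Icc s t, |A x y| ≤ A₀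
  slope : ∀ b, ∀ x ∈ Icc (0 : ℝ) 1, ∀ y ∈ Icc s t, c * branchSlope a b ≤ D x y
  taylor : ∀ x ∈ Icc (0 : ℝ) 1, ∀ x' ∈ Icc (0 : ℝ) 1, ∀ y ∈ Icc s t, ∀ y' ∈ Icc s t,
    |F x' y' - F x y - A x y * (x' - x) - D x y * (y' - y)| ≤ B * (|x' - x| + |y' - y|) ^ 2

section Invariant

variable {a c s t A₀ B L : ℝ} {F A D : ℝ → ℝ → ℝ} {ℓ : ℝ → ℝ}

theorem SecondOrder.taylor_lipschitz (H : SecondOrder a c s t A₀ B F A D)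
    (hℓ : ∀ x ∈ Icc (0 : ℝ) 1, ℓ x ∈ Icc s t)
    (hL : ∀ x ∈ Icc (0 : ℝ) 1, ∀ x' ∈ Icc (0 : ℝ) 1, |ℓ x' - ℓ x| ≤ L * |x' - x|)
    {x x' : ℝ} (hx : x ∈ Icc (0 : ℝ) 1) (hx' : x' ∈ Icc (0 : ℝ) 1) :
    |F x' (ℓ x') - F x (ℓ x) - A x (ℓ x) * (x' - x) - D x (ℓ x) * (ℓ x' - ℓ x)| ≤
      B * (1 + L) ^ 2 * (x' - x) ^ 2 := by
  refine (H.taylor x hx x' hx' _ (hℓ x hx) _ (hℓ x' hx')).trans ?_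
  rw [mul_assoc]
  refine mul_le_mul_of_nonneg_left ?_ H.B_nonneg
  rw [← sq_abs (x' - x), ← mul_pow]
  refine pow_le_pow_left₀ (by positivity) ?_ 2
  have := hL x hx x' hx'
  linarith

/-- A Lipschitz invariant graph has first order Taylor expansions with quadratic error. -/
theorem SecondOrder.exists_quadratic (H : SecondOrder a c s t A₀ B F A D) (ha : 0 < a)
    (ha1 : a < 1) (hc : 1 < c) (hℓ : ∀ x ∈ Icc (0 : ℝ) 1, ℓ x ∈ Icc s t)
    (hL : ∀ x ∈ Icc (0 : ℝ) 1, ∀ x' ∈ Icc (0 : ℝ) 1, |ℓ x' - ℓ x| ≤ L * |x' - x|)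
    (hinv : ∀ b, ∀ x ∈ Icc (0 : ℝ) 1, ℓ (branch a b x) = F x (ℓ x)) :
    ∃ X : ℝ → ℝ, ∃ K M : ℝ, 0 ≤ K ∧ 0 ≤ M ∧ (∀ x ∈ Icc (0 : ℝ) 1, |X x| ≤ M) ∧
      ∀ x ∈ Icc (0 : ℝ) 1, ∀ x' ∈ Icc (0 : ℝ) 1,
        |ℓ x' - ℓ x - X x * (x' - x)| ≤ K * (x' - x) ^ 2 := by
  have hc0 : 0 < c := one_pos.trans hc
  have hca : 0 < c * a := mul_pos hc0 ha
  have hD : ∀ x ∈ Icc (0 : ℝ) 1, c * a ≤ D x (ℓ x) := fun x hx =>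
    H.slope false x hx _ (hℓ x hx)
  have hmem : ∀ x ∈ Icc (0 : ℝ) 1, a * x ∈ Icc (0 : ℝ) 1 := fun x hx =>
    branch_mem ha ha1 false hx
  have hinv0 : ∀ x ∈ Icc (0 : ℝ) 1, ℓ (a * x) = F x (ℓ x) := hinv false
  -- Formal differentiation of `ℓ (a x) = F x (ℓ x)` gives `a X(a x) = A + D X(x)`. Solved for
  -- `X(x)`, it has coefficient `a / D ≤ 1 / c < 1`.
  obtain ⟨X, hX, M, hM⟩ := exists_bounded_solution (a := a) (U := A₀ / (c * a)) (θ := 1 / c)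
    ha ha1 (by rw [div_lt_one hc0]; exact hc) (u := fun x => -A x (ℓ x) / D x (ℓ x))
    (w := fun x => a / D x (ℓ x))
    (fun x hx => by
      have h1 := H.bound x hx _ (hℓ x hx)
      rw [abs_div, abs_neg, abs_of_pos (hca.trans_le (hD x hx))]
      exact div_le_div₀ ((abs_nonneg _).trans h1) h1 hca (hD x hx))
    (fun x hx => by
      have hD0 := hca.trans_le (hD x hx)
      rw [abs_div, abs_of_pos ha, abs_of_pos hD0, div_le_div_iff₀ hD0 hc0]
      linarith [hD x hx])
  have hXeq : ∀ x ∈ Icc (0 : ℝ) 1, a * X (a * x) = A x (ℓ x) + D x (ℓ x) * X x := by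
    intro x hx
    have hD0 := (hca.trans_le (hD x hx)).ne'
    rw [hX x hx]
    field_simp
    ring
  have hM0 : 0 ≤ M := (abs_nonneg _).trans (hM 0 ⟨le_rfl, zero_le_one⟩)
  have hL0 : 0 ≤ L := by
    have := (abs_nonneg _).trans (hL 0 ⟨le_rfl, zero_le_one⟩ 1 ⟨zero_le_one, le_rfl⟩)
    simpa using this
  set B' := B * (1 + L) ^ 2 with hB'
  have hB'0 : 0 ≤ B' := mul_nonneg H.B_nonneg (sq_nonneg _)
  -- Chosen so that `K a² + B' ≤ c a K`: a quadratic error bound with this constant reproduces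
  -- itself under one step.
  set K := B' / (c * a * (1 - a)) with hK
  have h1a : 0 < 1 - a := sub_pos.2 ha1
  have hK0 : 0 ≤ K := by positivity
  have hKB : K * (c * a * (1 - a)) = B' := by rw [hK]; field_simp
  have step : ∀ n : ℕ, ∀ x ∈ Icc (0 : ℝ) 1, ∀ x' ∈ Icc (0 : ℝ) 1,
      |ℓ x' - ℓ x - X x * (x' - x)| ≤
        (L + M) * (1 / c) ^ n * |x' - x| + K * (x' - x) ^ 2 := by
    intro n
    induction n with
    | zero =>
      intro x hx x' hx'
      have h1 := hL x hx x' hx'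
      have h2 : |X x * (x' - x)| ≤ M * |x' - x| := by
        rw [abs_mul]; exact mul_le_mul_of_nonneg_right (hM x hx) (abs_nonneg _)
      have h3 := abs_sub (ℓ x' - ℓ x) (X x * (x' - x))
      have h4 : 0 ≤ K * (x' - x) ^ 2 := mul_nonneg hK0 (sq_nonneg _)
      rw [pow_zero, mul_one]
      linarith
    | succ n ih =>
      intro x hx x' hx'
      have h1 := ih (a * x) (hmem x hx) (a * x') (hmem x' hx')
      have h2 := H.taylor_lipschitz hℓ hL hx hx'
      rw [hinv0 x hx, hinv0 x' hx', ← mul_sub, abs_mul, abs_of_pos ha] at h1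
      -- The remainder at `(x, x')` is the one at `(a x, a x')` minus a Taylor error, divided by `D
      -- ≥ c a`. Hence the linear part of its bound shrinks by `1 / c` at each step.
      have h3 : D x (ℓ x) * (ℓ x' - ℓ x - X x * (x' - x)) =
          (F x' (ℓ x') - F x (ℓ x) - X (a * x) * (a * (x' - x))) -
          (F x' (ℓ x') - F x (ℓ x) - A x (ℓ x) * (x' - x) - D x (ℓ x) * (ℓ x' - ℓ x)) := by
        have := hXeq x hx
        linear_combination (x' - x) * this
      have h4 : D x (ℓ x) * |ℓ x' - ℓ x - X x * (x' - x)| ≤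
          (L + M) * (1 / c) ^ n * (a * |x' - x|) + K * (a * (x' - x)) ^ 2 +
            B' * (x' - x) ^ 2 := by
        have h5 := congrArg abs h3
        rw [abs_mul, abs_of_pos (hca.trans_le (hD x hx))] at h5
        rw [h5]
        exact (abs_sub _ _).trans (add_le_add h1 h2)
      have h5 : c * a * |ℓ x' - ℓ x - X x * (x' - x)| ≤
          c * a * ((L + M) * (1 / c) ^ (n + 1) * |x' - x| + K * (x' - x) ^ 2) := by
        refine ((mul_le_mul_of_nonneg_right (hD x hx) (abs_nonneg _)).trans h4).trans ?_
        have e1 : c * a * ((L + M) * (1 / c) ^ (n + 1) * |x' - x|) =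
            (L + M) * (1 / c) ^ n * (a * |x' - x|) := by
          rw [pow_succ]; field_simp
        rw [mul_add, e1]
        have h6 : K * a ^ 2 + B' ≤ c * a * K := by
          rw [← hKB]
          have : K * a ^ 2 ≤ K * (c * a * a) := by
            refine mul_le_mul_of_nonneg_left ?_ hK0
            nlinarith [mul_pos ha ha]
          linarith
        have := mul_le_mul_of_nonneg_right h6 (sq_nonneg (x' - x))
        linarith
      exact le_of_mul_le_mul_left h5 hca
  refine ⟨X, K, M, hK0, hM0, hM, fun x hx x' hx' => ?_⟩
  have hpow : Tendsto (fun n : ℕ => (1 / c) ^ n) atTop (𝓝 0) :=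
    tendsto_pow_atTop_nhds_zero_of_lt_one (by positivity) (by rw [div_lt_one hc0]; exact hc)
  have hlim : Tendsto (fun n : ℕ => (L + M) * (1 / c) ^ n * |x' - x| + K * (x' - x) ^ 2) atTop
      (𝓝 ((L + M) * 0 * |x' - x| + K * (x' - x) ^ 2)) :=
    ((hpow.const_mul _).mul_const _).add_const _
  rw [mul_zero, zero_mul, zero_add] at hlim
  exact ge_of_tendsto' hlim fun n => step n x hx x' hx'

/-- The derivative of an invariant graph transforms according to the chain rule. -/
theorem SecondOrder.slope_branch (H : SecondOrder a c s t A₀ B F A D) (ha : 0 < a)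
    (ha1 : a < 1) (hℓ : ∀ x ∈ Icc (0 : ℝ) 1, ℓ x ∈ Icc s t)
    (hL : ∀ x ∈ Icc (0 : ℝ) 1, ∀ x' ∈ Icc (0 : ℝ) 1, |ℓ x' - ℓ x| ≤ L * |x' - x|)
    (hinv : ∀ b, ∀ x ∈ Icc (0 : ℝ) 1, ℓ (branch a b x) = F x (ℓ x)) {X : ℝ → ℝ} {K : ℝ}
    (hX : ∀ x ∈ Icc (0 : ℝ) 1, ∀ x' ∈ Icc (0 : ℝ) 1,
        |ℓ x' - ℓ x - X x * (x' - x)| ≤ K * (x' - x) ^ 2) (b : Bool) {x : ℝ}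
    (hx : x ∈ Icc (0 : ℝ) 1) :
    branchSlope a b * X (branch a b x) = A x (ℓ x) + D x (ℓ x) * X x := by
  rw [← sub_eq_zero]
  -- Both sides are slopes of the same function `ℓ ∘ branch a b` at `x`, each valid up to a
  -- quadratic error.
  refine eq_zero_of_abs_mul_le (C := K * branchSlope a b ^ 2 + B * (1 + L) ^ 2 + |D x (ℓ x)| * K)
    hx fun x' hx' => ?_
  have h1 := hX _ (branch_mem ha ha1 b hx) _ (branch_mem ha ha1 b hx')
  rw [hinv b x hx, hinv b x' hx', branch_sub] at h1
  have h2 := H.taylor_lipschitz hℓ hL hx hx'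
  have h3 : |D x (ℓ x) * (ℓ x' - ℓ x - X x * (x' - x))| ≤ |D x (ℓ x)| * (K * (x' - x) ^ 2) := by
    rw [abs_mul]
    exact mul_le_mul_of_nonneg_left (hX x hx x' hx') (abs_nonneg _)
  rw [abs_le] at h1 h2 h3 ⊢
  constructor <;> nlinarith [h1.1, h1.2, h2.1, h2.2, h3.1, h3.2]

/-- Invariant graphs match up to first order at the two ends of `[0, 1]`. -/
theorem SecondOrder.match_ends (H : SecondOrder a c s t A₀ B F A D) (ha : 0 < a)
    (ha1 : a < 1) (hc : 1 < c) (hℓ : ∀ x ∈ Icc (0 : ℝ) 1, ℓ x ∈ Icc s t)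
    (hL : ∀ x ∈ Icc (0 : ℝ) 1, ∀ x' ∈ Icc (0 : ℝ) 1, |ℓ x' - ℓ x| ≤ L * |x' - x|)
    (hinv : ∀ b, ∀ x ∈ Icc (0 : ℝ) 1, ℓ (branch a b x) = F x (ℓ x))
    (hF : Function.Injective (F 0)) (hF01 : F 0 = F 1) (hA01 : A 0 = A 1) (hD01 : D 0 = D 1)
    {X : ℝ → ℝ} {K : ℝ} (hX : ∀ x ∈ Icc (0 : ℝ) 1, ∀ x' ∈ Icc (0 : ℝ) 1,
        |ℓ x' - ℓ x - X x * (x' - x)| ≤ K * (x' - x) ^ 2) :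
    ℓ 0 = ℓ 1 ∧ X 0 = X 1 := by
  have m0 : (0 : ℝ) ∈ Icc (0 : ℝ) 1 := ⟨le_rfl, zero_le_one⟩
  have m1 : (1 : ℝ) ∈ Icc (0 : ℝ) 1 := ⟨zero_le_one, le_rfl⟩
  have b00 : branch a false 0 = 0 := by simp [branch]
  have b01 : branch a false 1 = a := by simp [branch]
  have b10 : branch a true 0 = a := by simp [branch]
  have b11 : branch a true 1 = 1 := by simp [branch]
  have e1 : ℓ 0 = ℓ 1 := by
    apply hF
    have h1 := hinv true 0 m0
    have h2 := hinv false 1 m1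
    rw [b10] at h1
    rw [b01] at h2
    rw [← h1, h2, hF01]
  refine ⟨e1, ?_⟩
  -- Four linear relations among `X 0`, `X a`, `X 1`: the branches fix `0` and `1` and send `1` and
  -- `0` respectively to `a`. They leave only `a = 1/2`, where the slopes agree, or `X a = 0`, where
  -- both end slopes vanish.
  have r00 := H.slope_branch ha ha1 hℓ hL hinv hX false m0
  have r01 := H.slope_branch ha ha1 hℓ hL hinv hX false m1
  have r10 := H.slope_branch ha ha1 hℓ hL hinv hX true m0
  have r11 := H.slope_branch ha ha1 hℓ hL hinv hX true m1
  have d1 := H.slope false 0 m0 _ (hℓ 0 m0)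
  rw [b00, hA01, hD01, e1] at r00
  rw [b01] at r01
  rw [b10, hA01, hD01, e1] at r10
  rw [b11] at r11
  rw [hD01, e1] at d1
  simp only [branchSlope, cond_true, cond_false] at r00 r01 r10 r11 d1
  generalize A 1 (ℓ 1) = α at *
  generalize D 1 (ℓ 1) = d at *
  have h1a : 0 < 1 - a := sub_pos.2 ha1
  have hda : 0 < d - a * (1 - a) := by nlinarith [mul_pos ha ha]
  have q1 : a * X 0 = (1 - a) * X a := by linarith
  have q2 : (1 - a) * X 1 = a * X a := by linarith
  have q3 : (1 - 2 * a) * ((d - a * (1 - a)) * X a) = 0 := by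
    linear_combination -(a * (1 - a)) * r00 + (a * (1 - a)) * r11 - (1 - a) * (d - a) * q1 +
      a * (d - (1 - a)) * q2
  rcases mul_eq_zero.1 q3 with h | h
  · have ha2 : a = 1 / 2 := by linarith
    rw [ha2] at q1 q2
    linarith
  · have hXa : X a = 0 := (mul_eq_zero.1 h).resolve_left hda.ne'
    rw [hXa, mul_zero] at q1 q2
    rw [(mul_eq_zero.1 q1).resolve_left ha.ne', (mul_eq_zero.1 q2).resolve_left h1a.ne']

end Invariant

/-! ### Periodic extension -/

/-- Adding the expansions based at `x` and at `x'` cancels the increments of `g` and leaves `(X x -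
X x') (x - x')`. -/
theorem lipschitz_of_quadratic {s : Set ℝ} {g X : ℝ → ℝ} {K : ℝ}
    (hX : ∀ x ∈ s, ∀ x' ∈ s, |g x' - g x - X x * (x' - x)| ≤ K * (x' - x) ^ 2) {x x' : ℝ}
    (hx : x ∈ s) (hx' : x' ∈ s) : |X x - X x'| ≤ 2 * K * |x - x'| := by
  rcases eq_or_ne x x' with rfl | hne
  · simp
  have h0 : 0 < |x - x'| := abs_pos.2 (sub_ne_zero.2 hne)
  refine le_of_mul_le_mul_right ?_ h0
  have h1 := hX x hx x' hx'
  have h2 := hX x' hx' x hx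
  rw [← abs_mul, mul_assoc, ← sq, sq_abs]
  rw [abs_le] at h1 h2 ⊢
  constructor <;> nlinarith [h1.1, h1.2, h2.1, h2.2]

/-- At distance at most `1` it suffices to cross one integer `k`. Expanding through `k` costs the
two squares and a cross term `2 K (x' - k) (k - x)` from the Lipschitz bound on `X`, which add up to
exactly `K (x' - x)²`; the constant is not worsened. -/
theorem quadratic_periodic {ℓ X : ℝ → ℝ} {K : ℝ} (hℓ01 : ℓ 0 = ℓ 1)
    (hX01 : X 0 = X 1)
    (hX : ∀ x ∈ Icc (0 : ℝ) 1, ∀ x' ∈ Icc (0 : ℝ) 1,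
        |ℓ x' - ℓ x - X x * (x' - x)| ≤ K * (x' - x) ^ 2) {x x' : ℝ} (hd : |x' - x| ≤ 1) :
    |ℓ (Int.fract x') - ℓ (Int.fract x) - X (Int.fract x) * (x' - x)| ≤ K * (x' - x) ^ 2 := by
  have hrepr : ∀ h : ℝ → ℝ, h 0 = h 1 → ∀ n : ℤ, ∀ z ∈ Icc (n : ℝ) (n + 1),
      h (Int.fract z) = h (z - n) := by
    intro h h01 n z hz
    rcases hz.2.lt_or_eq with hlt | heq
    · have : ⌊z⌋ = n := Int.floor_eq_iff.2 ⟨hz.1, hlt⟩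
      rw [Int.fract, this]
    · have : Int.fract z = 0 := by
        rw [heq]; simp
      rw [this, heq, add_sub_cancel_left, h01]
  have cell : ∀ n : ℤ, ∀ z ∈ Icc (n : ℝ) (n + 1), ∀ z' ∈ Icc (n : ℝ) (n + 1),
      |ℓ (Int.fract z') - ℓ (Int.fract z) - X (Int.fract z) * (z' - z)| ≤ K * (z' - z) ^ 2 := by
    intro n z hz z' hz'
    have := hX (z - n) ⟨by linarith [hz.1], by linarith [hz.2]⟩ (z' - n)
      ⟨by linarith [hz'.1], by linarith [hz'.2]⟩
    rw [hrepr ℓ hℓ01 n z hz, hrepr ℓ hℓ01 n z' hz', hrepr X hX01 n z hz]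
    rwa [sub_sub_sub_cancel_right] at this
  have glue : ∀ (n : ℤ) (z z' : ℝ), (z ∈ Icc (n : ℝ) (n + 1)) → ∀ (n' : ℤ),
      (z' ∈ Icc (n' : ℝ) (n' + 1)) → ∀ k : ℝ, k ∈ Icc (n : ℝ) (n + 1) →
      k ∈ Icc (n' : ℝ) (n' + 1) → 0 ≤ (z' - k) * (k - z) →
      |ℓ (Int.fract z') - ℓ (Int.fract z) - X (Int.fract z) * (z' - z)| ≤ K * (z' - z) ^ 2 := by
    intro n z z' hz n' hz' k hk hk' hs
    have h1 := cell n z hz k hk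
    have h2 := cell n' k hk' z' hz'
    have h3 := lipschitz_of_quadratic (s := Icc (n : ℝ) (n + 1))
      (g := fun z => ℓ (Int.fract z)) (X := fun z => X (Int.fract z)) (cell n) hk hz
    have h4 : |(X (Int.fract k) - X (Int.fract z)) * (z' - k)| ≤ 2 * K * ((z' - k) * (k - z)) := by
      rw [abs_mul]
      refine (mul_le_mul_of_nonneg_right h3 (abs_nonneg _)).trans_eq ?_
      rw [mul_assoc, ← abs_mul, mul_comm (k - z), abs_of_nonneg hs]
    have e : ℓ (Int.fract z') - ℓ (Int.fract z) - X (Int.fract z) * (z' - z) =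
        (ℓ (Int.fract z') - ℓ (Int.fract k) - X (Int.fract k) * (z' - k)) +
        (ℓ (Int.fract k) - ℓ (Int.fract z) - X (Int.fract z) * (k - z)) +
        (X (Int.fract k) - X (Int.fract z)) * (z' - k) := by ring
    rw [e]
    refine (abs_add_three _ _ _).trans ((add_le_add (add_le_add h2 h1) h4).trans_eq ?_)
    ring
  obtain ⟨d1, d2⟩ := abs_le.1 hd
  have f1 := Int.floor_le x
  have f2 := (Int.lt_floor_add_one x).le
  have f1' := Int.floor_le x'
  have f2' := (Int.lt_floor_add_one x').le
  rcases lt_trichotomy ⌊x⌋ ⌊x'⌋ with h | h | h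
  · have h1 : ((⌊x⌋ : ℝ) + 1) ≤ ⌊x'⌋ := by exact_mod_cast h
    have h3 : ⌊x'⌋ < ⌊x⌋ + 2 := by
      rw [Int.floor_lt]; push_cast; linarith [Int.lt_floor_add_one x]
    have h4 : (⌊x'⌋ : ℝ) = ⌊x⌋ + 1 := by exact_mod_cast (show ⌊x'⌋ = ⌊x⌋ + 1 by omega)
    exact glue ⌊x⌋ x x' ⟨f1, f2⟩ ⌊x'⌋ ⟨f1', f2'⟩ ⌊x'⌋ ⟨by linarith, by linarith⟩
      ⟨le_rfl, by linarith⟩ (mul_nonneg (by linarith) (by linarith))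
  · exact cell ⌊x⌋ x ⟨f1, f2⟩ x' (by rw [h]; exact ⟨f1', f2'⟩)
  · have h1 : ((⌊x'⌋ : ℝ) + 1) ≤ ⌊x⌋ := by exact_mod_cast h
    have h3 : ⌊x⌋ < ⌊x'⌋ + 2 := by
      rw [Int.floor_lt]; push_cast; linarith [Int.lt_floor_add_one x']
    have h4 : (⌊x⌋ : ℝ) = ⌊x'⌋ + 1 := by exact_mod_cast (show ⌊x⌋ = ⌊x'⌋ + 1 by omega)
    exact glue ⌊x⌋ x x' ⟨f1, f2⟩ ⌊x'⌋ ⟨f1', f2'⟩ ⌊x⌋ ⟨le_rfl, by linarith⟩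
      ⟨by linarith, by linarith⟩ (mul_nonneg_of_nonpos_of_nonpos (by linarith) (by linarith))

theorem hasDerivAt_of_quadratic {g : ℝ → ℝ} {m K x : ℝ}
    (h : ∀ x', |x' - x| ≤ 1 → |g x' - g x - m * (x' - x)| ≤ K * (x' - x) ^ 2) :
    HasDerivAt g m x := by
  rw [hasDerivAt_iff_isLittleO]
  have h1 : (fun x' => g x' - g x - (x' - x) • m) =O[𝓝 x] fun x' => (x' - x) ^ 2 := by
    refine Asymptotics.IsBigO.of_bound K ?_
    filter_upwards [Metric.closedBall_mem_nhds x one_pos] with x' hx'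
    rw [smul_eq_mul, mul_comm, Real.norm_eq_abs, Real.norm_eq_abs, abs_of_nonneg (sq_nonneg (x' - x))]
    exact h x' (by rwa [← Real.dist_eq])
  refine h1.trans_isLittleO ?_
  have h2 : (fun x' : ℝ => x' - x) =o[𝓝 x] fun _ => (1 : ℝ) := by
    rw [Asymptotics.isLittleO_one_iff]
    have : Tendsto (fun x' : ℝ => x' - x) (𝓝 x) (𝓝 (x - x)) := tendsto_id.sub_const x
    rwa [sub_self] at this
  have h3 := h2.mul_isBigO (Asymptotics.isBigO_refl (fun x' : ℝ => x' - x) (𝓝 x))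
  simpa [sq] using h3

/-- A function of the stable coordinate with uniform quadratic Taylor bounds is of class
`C^{1+Lip}`. -/
theorem isC1Lip_of_quadratic {φ : Torus2 → ℝ} {g X : ℝ → ℝ} {K M : ℝ} (hK : 0 ≤ K)
    (hφ : ∀ ξ : Torus, ∀ x : ℝ, φ (ξ, (x : Torus)) = g x) (hM : ∀ x, |X x| ≤ M)
    (hX : ∀ x x', |x' - x| ≤ 1 → |g x' - g x - X x * (x' - x)| ≤ K * (x' - x) ^ 2) :
    IsC1Lip φ := by
  have hM0 : 0 ≤ M := (abs_nonneg _).trans (hM 0)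
  have hg : ∀ x, HasDerivAt g (X x) x := fun x => hasDerivAt_of_quadratic (hX x)
  have hlift : lift2 φ = fun p => g p.2 := funext fun p => hφ _ _
  have hfd : ∀ p : ℝ × ℝ, HasFDerivAt (lift2 φ) (X p.2 • ContinuousLinearMap.snd ℝ ℝ ℝ) p := by
    intro p
    rw [hlift]
    exact (hg p.2).comp_hasFDerivAt p hasFDerivAt_snd
  have hfde : fderiv ℝ (lift2 φ) = fun p => X p.2 • ContinuousLinearMap.snd ℝ ℝ ℝ :=
    funext fun p => (hfd p).fderiv
  have hXl : ∀ x x', |X x - X x'| ≤ (2 * K + 2 * M) * |x - x'| := by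
    intro x x'
    rcases le_total |x' - x| 1 with h | h
    · have h1 := lipschitz_of_quadratic (s := {x, x'}) (g := g) (X := X) (K := K)
        (by
          intro u hu v hv
          refine hX u v ?_
          rcases hu with rfl | rfl <;> rcases hv with rfl | rfl
          · simp
          · exact h
          · rwa [abs_sub_comm]
          · simp) (mem_insert x {x'}) (mem_insert_of_mem x rfl)
      nlinarith [abs_nonneg (x - x')]
    · rw [abs_sub_comm] at h
      have h1 := abs_sub (X x) (X x')
      have := hM x
      have := hM x'
      nlinarith
  have hlip : LipschitzWith (2 * K + 2 * M).toNNReal (fderiv ℝ (lift2 φ)) := by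
    refine LipschitzWith.of_dist_le_mul fun p p' => ?_
    rw [hfde, dist_eq_norm, Real.coe_toNNReal _ (by positivity)]
    have e : X p.2 • ContinuousLinearMap.snd ℝ ℝ ℝ - X p'.2 • ContinuousLinearMap.snd ℝ ℝ ℝ =
        (X p.2 - X p'.2) • ContinuousLinearMap.snd ℝ ℝ ℝ := by
      ext <;> simp
    simp only
    rw [e, norm_smul]
    have h1 : ‖X p.2 - X p'.2‖ ≤ (2 * K + 2 * M) * dist p p' := by
      refine (hXl _ _).trans (mul_le_mul_of_nonneg_left ?_ (by positivity))
      rw [← Real.dist_eq, Prod.dist_eq]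
      exact le_max_right _ _
    exact (mul_le_of_le_one_right (norm_nonneg _) (ContinuousLinearMap.norm_snd_le ℝ ℝ ℝ)).trans h1
  exact ⟨contDiff_one_iff_fderiv.2 ⟨fun p => (hfd p).differentiableAt, hlip.continuous⟩, _, hlip⟩

/-! ### The lifted system of a skew product -/

theorem rep_coe_eq_fract (x : ℝ) : rep (x : Torus) = Int.fract x := by
  have h := AddCircle.coe_equivIco_mk_apply (1 : ℝ) x
  rw [div_one, mul_one] at h
  exact h

theorem continuous_coe_torus : Continuous ((↑) : ℝ → Torus) := AddCircle.continuous_mk' 1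

section Lift

variable {a : ℝ} {f : Torus → ℝ → ℝ} {s t s' t' : ℝ}

theorem Standing.Icc_subset_Ioo (hf : Standing a f s t s' t') : Icc s t ⊆ Ioo s' t' := by
  have h := hf.I_subset
  rwa [interior_Icc] at h

/-- Every point has a `tau`-preimage on each branch, so hyperbolicity evaluated at both preimages
bounds the same fibre derivative against both branch slopes. -/
theorem Standing.exists_slope (hf : Standing a f s t s' t') :
    ∃ c : ℝ, 1 < c ∧ ∀ b, ∀ z, ∀ y ∈ Icc s t, c * branchSlope a b ≤ deriv (f z) y := by
  obtain ⟨c, hc, h⟩ := hf.partially_hyperbolic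
  refine ⟨c, hc, fun b z y hy => ?_⟩
  have hy' : y ∈ Icc s' t' := Ioo_subset_Icc_self (hf.Icc_subset_Ioo hy)
  have hz := rep_mem z
  have hz' : rep z ∈ Icc (0 : ℝ) 1 := Ico_subset_Icc_self hz
  have ha := hf.a_pos
  have ha1 := hf.a_lt_one
  cases b
  · have := h ((a * rep z : ℝ) : Torus) y hy'
    rw [tauSlope_mul ha ha1 hz, tau_mul ha ha1 hz', coe_rep, le_inv_mul_iff₀ ha] at this
    simp only [branchSlope, cond_false]
    linarith
  · have := h ((a + (1 - a) * rep z : ℝ) : Torus) y hy'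
    rw [tauSlope_add_mul ha ha1 hz, tau_add_mul ha ha1 hz', coe_rep,
      le_inv_mul_iff₀ (sub_pos.2 ha1)] at this
    simp only [branchSlope, cond_true]
    linarith

theorem Standing.contDiffOn_lift (hf : Standing a f s t s' t') :
    ContDiffOn ℝ 2 (fun p : ℝ × ℝ => f (p.1 : Torus) p.2) (univ ×ˢ Ioo s' t') :=
  hf.smooth_joint.mono (prod_mono_right Ioo_subset_Icc_self)

theorem Standing.rectangle_subset (hf : Standing a f s t s' t') :
    Icc (0 : ℝ) 1 ×ˢ Icc s t ⊆ univ ×ˢ Ioo s' t' :=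
  prod_mono (subset_univ _) hf.Icc_subset_Ioo

theorem Standing.differentiableAt_lift (hf : Standing a f s t s' t') {x y : ℝ}
    (hy : y ∈ Icc s t) :
    DifferentiableAt ℝ (fun p : ℝ × ℝ => f (p.1 : Torus) p.2) (x, y) :=
  ((hf.contDiffOn_lift.differentiableOn (by norm_num)) (x, y)
    ⟨mem_univ _, hf.Icc_subset_Ioo hy⟩).differentiableAt
    ((isOpen_univ.prod isOpen_Ioo).mem_nhds ⟨mem_univ _, hf.Icc_subset_Ioo hy⟩)

theorem Standing.deriv_eq_fderiv (hf : Standing a f s t s' t') {x y : ℝ} (hy : y ∈ Icc s t) :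
    fderiv ℝ (fun p : ℝ × ℝ => f (p.1 : Torus) p.2) (x, y) (0, 1) = deriv (f (x : Torus)) y := by
  have h1 : HasDerivAt (fun y : ℝ => (x, y)) ((0 : ℝ), (1 : ℝ)) y :=
    (hasDerivAt_const y x).prodMk (hasDerivAt_id y)
  exact ((hf.differentiableAt_lift hy).hasFDerivAt.comp_hasDerivAt y h1).deriv.symm

theorem fderiv_lift_add_one (f : Torus → ℝ → ℝ) (y : ℝ) :
    fderiv ℝ (fun p : ℝ × ℝ => f (p.1 : Torus) p.2) (0, y) =
      fderiv ℝ (fun p : ℝ × ℝ => f (p.1 : Torus) p.2) (1, y) := by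
  have h := fderiv_comp_add_right (𝕜 := ℝ) (f := fun p : ℝ × ℝ => f (p.1 : Torus) p.2)
    (x := ((0 : ℝ), y)) ((1 : ℝ), (0 : ℝ))
  have e : (fun p : ℝ × ℝ => (fun p : ℝ × ℝ => f (p.1 : Torus) p.2) (p + ((1 : ℝ), (0 : ℝ)))) =
      fun p : ℝ × ℝ => f (p.1 : Torus) p.2 := by
    funext p
    simp only [Prod.fst_add, Prod.snd_add, add_zero]
    rw [AddCircle.coe_add, coe_one_torus, AddCircle.coe_zero, add_zero]
  rw [e] at h
  rw [h]
  simp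

theorem Standing.exists_secondOrder (hf : Standing a f s t s' t') {c : ℝ}
    (hc : ∀ b, ∀ z, ∀ y ∈ Icc s t, c * branchSlope a b ≤ deriv (f z) y) :
    ∃ A₀ B, SecondOrder a c s t A₀ B (fun x y => f (x : Torus) y)
      (fun x y => fderiv ℝ (fun p : ℝ × ℝ => f (p.1 : Torus) p.2) (x, y) (1, 0))
      (fun x y => fderiv ℝ (fun p : ℝ × ℝ => f (p.1 : Torus) p.2) (x, y) (0, 1)) := by
  set Φ : ℝ × ℝ → ℝ := fun p => f (p.1 : Torus) p.2 with hΦ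
  have hconv : Convex ℝ (Icc (0 : ℝ) 1 ×ˢ Icc s t) := (convex_Icc 0 1).prod (convex_Icc s t)
  have hcomp : IsCompact (Icc (0 : ℝ) 1 ×ˢ Icc s t) := isCompact_Icc.prod isCompact_Icc
  have hd1 : ContDiffOn ℝ 1 (fderiv ℝ Φ) (Icc (0 : ℝ) 1 ×ˢ Icc s t) :=
    (hf.contDiffOn_lift.fderiv_of_isOpen (isOpen_univ.prod isOpen_Ioo) (by norm_num)).mono
      hf.rectangle_subset
  obtain ⟨B, hB⟩ := hd1.exists_lipschitzOnWith one_ne_zero hconv hcomp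
  obtain ⟨A₀, hA₀⟩ := hcomp.exists_bound_of_continuousOn hd1.continuousOn
  refine ⟨A₀, B, B.2, fun x hx y hy => ?_, fun b x _ y hy => ?_,
    fun x hx x' hx' y hy y' hy' => ?_⟩
  · refine ((fderiv ℝ Φ (x, y)).le_opNorm _).trans ?_
    have : ‖((1 : ℝ), (0 : ℝ))‖ = 1 := by simp [Prod.norm_def]
    rw [this, mul_one]
    exact hA₀ (x, y) ⟨hx, hy⟩
  · simp only [hΦ]
    rw [hf.deriv_eq_fderiv hy]
    exact hc b _ y hy
  · have hz : (x, y) ∈ Icc (0 : ℝ) 1 ×ˢ Icc s t := ⟨hx, hy⟩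
    have hz' : (x', y') ∈ Icc (0 : ℝ) 1 ×ˢ Icc s t := ⟨hx', hy'⟩
    -- On the ball of radius `R` the derivative differs from its value at the centre by at most `B *
    -- R`, so the mean value inequality gives a quadratic remainder.
    set R := ‖(x', y') - (x, y)‖
    have key := Convex.norm_image_sub_le_of_norm_hasFDerivWithin_le' (𝕜 := ℝ) (f := Φ)
      (f' := fderiv ℝ Φ) (φ := fderiv ℝ Φ (x, y)) (C := B * R)
      (s := (Icc (0 : ℝ) 1 ×ˢ Icc s t) ∩ Metric.closedBall (x, y) R)
      (fun w hw => (hf.differentiableAt_lift (x := w.1) hw.1.2).hasFDerivAt.hasFDerivWithinAt)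
      (fun w hw => by
        refine (hB.norm_sub_le hw.1 hz).trans (mul_le_mul_of_nonneg_left ?_ B.2)
        rw [← dist_eq_norm]
        exact Metric.mem_closedBall.1 hw.2)
      (hconv.inter (convex_closedBall _ _))
      (show (x, y) ∈ _ from ⟨hz, Metric.mem_closedBall_self (norm_nonneg _)⟩)
      (show (x', y') ∈ _ from ⟨hz', by rw [Metric.mem_closedBall, dist_eq_norm]⟩)
    have e1 : (x', y') - (x, y) =
        (x' - x) • ((1 : ℝ), (0 : ℝ)) + (y' - y) • ((0 : ℝ), (1 : ℝ)) := by
      ext <;> simp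
    have e2 : fderiv ℝ Φ (x, y) ((x', y') - (x, y)) =
        fderiv ℝ Φ (x, y) (1, 0) * (x' - x) + fderiv ℝ Φ (x, y) (0, 1) * (y' - y) := by
      rw [e1, map_add, map_smul, map_smul, smul_eq_mul, smul_eq_mul]
      ring
    rw [e2, ← sub_sub, Real.norm_eq_abs] at key
    refine key.trans ?_
    rw [mul_assoc, ← sq]
    refine mul_le_mul_of_nonneg_left (pow_le_pow_left₀ (norm_nonneg _) ?_ 2) B.2
    rw [Prod.norm_def]
    exact max_le (le_add_of_nonneg_right (abs_nonneg _)) (le_add_of_nonneg_left (abs_nonneg _))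

theorem Standing.tau_branch (hf : Standing a f s t s' t') (b : Bool) {x : ℝ}
    (hx : x ∈ Icc (0 : ℝ) 1) : tau a ((branch a b x : ℝ) : Torus) = (x : Torus) := by
  cases b
  · exact tau_mul hf.a_pos hf.a_lt_one hx
  · exact tau_add_mul hf.a_pos hf.a_lt_one hx

theorem Standing.exists_liftedSystem (hf : Standing a f s t s' t') {c : ℝ} (hc1 : 1 < c)
    (hc : ∀ b, ∀ z, ∀ y ∈ Icc s t, c * branchSlope a b ≤ deriv (f z) y) :
    ∃ A, LiftedSystem a c A s t (fun x y => f (x : Torus) y)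
      (fun x => phiPlus a f (0, (x : Torus))) (fun x => phiMinus a f (0, (x : Torus))) := by
  obtain ⟨A, hA⟩ := (hf.contDiffOn_lift.mono hf.rectangle_subset).exists_lipschitzOnWith
    two_ne_zero ((convex_Icc 0 1).prod (convex_Icc s t)) (isCompact_Icc.prod isCompact_Icc)
  refine ⟨A, hf.a_pos, hf.a_lt_one, hc1, A.2, fun x => hf.smooth_fibre x,
    fun x => hf.deriv_pos x, fun x => hf.schwarzian_neg x, fun x hx x' hx' y hy => ?_,
    fun b x hx y hy y' hy' hyy => ?_, fun x => (hf.phi_mem _).1, fun x => (hf.phi_mem _).2,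
    fun x => hf.phiMinus_le_phiPlus _, fun b x hx => ?_, fun b x hx => ?_⟩
  · have := hA.dist_le_mul (x, y) ⟨hx, hy⟩ (x', y) ⟨hx', hy⟩
    rwa [Real.dist_eq, Prod.dist_eq, dist_self, max_eq_left dist_nonneg, Real.dist_eq] at this
  · exact (convex_Icc s t).mul_sub_le_image_sub_of_le_deriv
      (hf.continuous_fibre _).continuousOn
      (((hf.smooth_fibre _).differentiable (by norm_num)).differentiableOn)
      (fun w hw => hc b _ w (interior_subset hw)) y hy y' hy' hyy
  · rw [hf.phiPlus_tau, hf.tau_branch b hx]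
  · rw [hf.phiMinus_tau, hf.tau_branch b hx]

theorem Standing.measurable_phiPlus_lift (hf : Standing a f s t s' t') :
    Measurable fun x : ℝ => phiPlus a f (0, (x : Torus)) := by
  obtain ⟨M, hM⟩ := hf.bounded
  refine measurable_of_tendsto_metrizable (fun n => ?_)
    (tendsto_pi_nhds.2 fun x : ℝ => hf.tendsto_phiPlus hM (0, (x : Torus)))
  exact ((hf.continuous_pullback n).comp
    (continuous_coe_torus.prodMk continuous_const)).measurable

theorem Standing.measurable_phiMinus_lift (hf : Standing a f s t s' t') :
    Measurable fun x : ℝ => phiMinus a f (0, (x : Torus)) := by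
  obtain ⟨M, hM⟩ := hf.bounded
  refine measurable_of_tendsto_metrizable (fun n => ?_)
    (tendsto_pi_nhds.2 fun x : ℝ => hf.tendsto_phiMinus hM (0, (x : Torus)))
  exact ((hf.continuous_pullback n).comp
    (continuous_coe_torus.prodMk continuous_const)).measurable

theorem Standing.mem_pinched (hf : Standing a f s t s' t') (ξ x : Torus) :
    (ξ, x) ∈ pinched a f ↔ phiPlus a f (0, x) = phiMinus a f (0, x) := by
  rw [← hf.phiPlus_eq ξ 0 x, ← hf.phiMinus_eq ξ 0 x]
  rfl

theorem Standing.volume_pinched_lift (hf : Standing a f s t s' t')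
    (h0 : volume (pinched a f) = 0) :
    volume (Ico (0 : ℝ) 1 ∩
      {x | phiPlus a f (0, (x : Torus)) = phiMinus a f (0, (x : Torus))}) = 0 := by
  set Q : Set Torus := {x | phiPlus a f (0, x) = phiMinus a f (0, x)} with hQ
  have hprod : pinched a f = univ ×ˢ Q := by
    ext ⟨ξ, x⟩
    rw [hf.mem_pinched]
    exact ⟨fun h => ⟨mem_univ _, h⟩, fun h => h.2⟩
  rw [hprod, Measure.volume_eq_prod, Measure.prod_prod, UnitAddCircle.measure_univ, one_mul] at h0
  have h1 := (UnitAddCircle.measurePreserving_mk 0).quasiMeasurePreserving.preimage_null h0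
  rw [Measure.restrict_apply' measurableSet_Ioc] at h1
  -- The quotient map preserves measure from `(0, 1]`, whereas representatives live in `[0, 1)`; the
  -- point `0` is added as a null set.
  refine measure_mono_null (t := (QuotientAddGroup.mk ⁻¹' Q ∩ Ioc (0 : ℝ) (0 + 1)) ∪ {0})
    ?_ (measure_union_null h1 (measure_singleton 0))
  rintro x ⟨hx, hxQ⟩
  rcases hx.1.eq_or_lt with h | h
  · exact Or.inr h.symm
  · exact Or.inl ⟨hxQ, h, by rw [zero_add]; exact hx.2.le⟩

theorem Standing.subset_closure_pinched (hf : Standing a f s t s' t')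
    (hd : Dense (pinched a f)) : Icc (0 : ℝ) 1 ⊆ closure {x : ℝ | x ∈ Ioo (0 : ℝ) 1 ∧
      phiPlus a f (0, (x : Torus)) = phiMinus a f (0, (x : Torus))} := by
  rw [← closure_Ioo (zero_ne_one (α := ℝ))]
  refine closure_minimal (fun x hx => ?_) isClosed_closure
  rw [mem_closure_iff]
  intro o ho hxo
  have hopen : IsOpen ((univ : Set Torus) ×ˢ (((↑) : ℝ → Torus) '' (o ∩ Ioo 0 1))) :=
    isOpen_univ.prod (QuotientAddGroup.isOpenMap_coe _ (ho.inter isOpen_Ioo))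
  obtain ⟨⟨ξ, z⟩, ⟨-, y, hy, hyz⟩, hP⟩ :=
    hd.inter_open_nonempty _ hopen ⟨(0, (x : Torus)), mem_univ _, x, ⟨hxo, hx⟩, rfl⟩
  rw [hf.mem_pinched] at hP
  simp only at hyz
  rw [← hyz] at hP
  exact ⟨y, hy.1, hy.2, hP⟩

end Lift

/-! ### The main theorem -/

/-- The limit graph is closed, and by density of `P` each of its points is a limit of points over
`P`. -/
theorem closure_graph_eq {P : Set Torus2} (hP : Dense P) {φ ψ : Torus2 → ℝ} (hφ : Continuous φ)
    (h : ∀ θ ∈ P, φ θ = ψ θ) : closure {p : Torus2 × ℝ | p.1 ∈ P ∧ p.2 = ψ p.1} = graphOf φ := by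
  apply Subset.antisymm
  · refine closure_minimal ?_ (isClosed_eq continuous_snd (hφ.comp continuous_fst))
    rintro ⟨θ, y⟩ ⟨h1, h2⟩
    exact h2.trans (h θ h1).symm
  · rintro ⟨θ, y⟩ hy
    have hy' : y = φ θ := hy
    rw [hy']
    exact map_mem_closure (f := fun θ => (θ, φ θ)) (continuous_id.prodMk hφ) (hP θ)
      fun θ' hθ' => ⟨hθ', h θ' hθ'⟩

theorem not_caseB1_of_graph {a : ℝ} {f : Torus → ℝ → ℝ} {I : Set ℝ} {φ : Torus2 → ℝ}
    (h : graphOf φ = pinchedClosure a f) : ¬ CaseB1 a f I := by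
  rintro ⟨θ, hθ⟩
  refine hθ.not_ge (Set.encard_le_one_iff.2 ?_)
  rintro y y' ⟨-, hy⟩ ⟨-, hy'⟩
  rw [← h] at hy hy'
  exact (show y = φ θ from hy).trans (show y' = φ θ from hy').symm

theorem graphOf_injective {φ ψ : Torus2 → ℝ} (h : graphOf φ = graphOf ψ) : φ = ψ := by
  funext θ
  have : (θ, φ θ) ∈ graphOf φ := rfl
  rw [h] at this
  exact this

theorem exists_isC1Lip {a : ℝ} {f : Torus → ℝ → ℝ} {s t s' t' : ℝ}
    (hf : Standing a f s t s' t') (hB : CaseB a f) (h0 : volume (pinched a f) = 0) :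
    ∃ φ : Torus2 → ℝ, IsC1Lip φ ∧ (∀ ξ ξ' x : Torus, φ (ξ, x) = φ (ξ', x)) ∧
      pinchedClosure a f = graphOf φ := by
  obtain ⟨c, hc1, hc⟩ := hf.exists_slope
  obtain ⟨A, H⟩ := hf.exists_liftedSystem hc1 hc
  obtain ⟨A₀, B, H2⟩ := hf.exists_secondOrder hc
  obtain ⟨M, hM⟩ := hf.bounded
  have ha := hf.a_pos
  have ha1 := hf.a_lt_one
  set p : ℝ → ℝ := fun x => phiPlus a f (0, (x : Torus)) with hpd
  set q : ℝ → ℝ := fun x => phiMinus a f (0, (x : Torus)) with hqd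
  obtain ⟨L, hL0, hL⟩ := H.exists_lipschitz
    (P := fun n x => pullback a f n (x : Torus) M)
    (fun n => (hf.continuous_pullback n).comp (continuous_coe_torus.prodMk continuous_const))
    (fun x => hf.antitone_pullback hM x) (fun x => hf.tendsto_phiPlus hM (0, (x : Torus)))
    hf.measurable_phiPlus_lift hf.measurable_phiMinus_lift (hf.volume_pinched_lift h0)
  have hemb : ∀ x : ℝ, ContinuousAt (fun x : ℝ => ((0 : Torus), (x : Torus))) x := fun x =>
    (continuous_const.prodMk continuous_coe_torus).continuousAt
  have hcont : ∀ x : ℝ, p x = q x → ContinuousAt p x ∧ ContinuousAt q x := by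
    intro x hx
    have hmem : ((0 : Torus), (x : Torus)) ∈ pinched a f := hx
    rw [hB.1] at hmem
    exact ⟨ContinuousAt.comp (f := fun x : ℝ => ((0 : Torus), (x : Torus))) hmem.1 (hemb x),
      ContinuousAt.comp (f := fun x : ℝ => ((0 : Torus), (x : Torus))) hmem.2 (hemb x)⟩
  -- Interior pinched points only, since the balls in the measure argument must fit inside `[0, 1]`.
  -- Pinching turns the one-sided gap estimate, used in both orders, into a two-sided Lipschitz
  -- bound.
  set S : Set ℝ := {x | x ∈ Ioo (0 : ℝ) 1 ∧ p x = q x} with hS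
  have hScl : Icc (0 : ℝ) 1 ⊆ closure S := hf.subset_closure_pinched hB.2.2
  have hLS : LipschitzOnWith L.toNNReal p S := by
    refine LipschitzOnWith.of_dist_le_mul fun x hx x' hx' => ?_
    rw [Real.coe_toNNReal _ hL0.le, Real.dist_eq, Real.dist_eq, abs_le]
    have h1 := hL x hx.1 x' hx'.1 (hcont x hx.2).1 (hcont x' hx'.2).2
    have h2 := hL x' hx'.1 x hx.1 (hcont x' hx'.2).1 (hcont x hx.2).2
    rw [← hx'.2] at h1
    rw [← hx.2, abs_sub_comm] at h2
    constructor <;> linarith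
  obtain ⟨ℓ, hℓL, hℓS⟩ := hLS.extend_real
  have hℓc := hℓL.continuous
  have hℓ : ∀ x ∈ Icc (0 : ℝ) 1, ℓ x ∈ Icc s t := fun x hx =>
    closure_minimal (fun z hz => by rw [mem_preimage, ← hℓS hz]; exact H.p_mem z)
      (isClosed_Icc.preimage hℓc) (hScl hx)
  have hℓlip : ∀ x ∈ Icc (0 : ℝ) 1, ∀ x' ∈ Icc (0 : ℝ) 1, |ℓ x' - ℓ x| ≤ L * |x' - x| := by
    intro x _ x' _
    have := hℓL.dist_le_mul x' x
    rwa [Real.coe_toNNReal _ hL0.le, Real.dist_eq, Real.dist_eq] at this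
  have hbr : ∀ b, Continuous (branch a b) := by
    intro b
    cases b
    · exact continuous_const.mul continuous_id
    · exact continuous_const.add (continuous_const.mul continuous_id)
  -- The branches map `S` into itself, where `ℓ = p` is invariant; continuity and density of `S`
  -- extend this to `[0, 1]`.
  have hinv : ∀ b, ∀ x ∈ Icc (0 : ℝ) 1, ℓ (branch a b x) = f (x : Torus) (ℓ x) := by
    intro b x hx
    refine closure_minimal (s := S) (t := {x | ℓ (branch a b x) = f (x : Torus) (ℓ x)})
      (fun z hz => ?_) (isClosed_eq (hℓc.comp (hbr b))
        (hf.cont.comp (continuous_coe_torus.prodMk hℓc))) (hScl hx)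
    have hz1 : z ∈ Icc (0 : ℝ) 1 := Ioo_subset_Icc_self hz.1
    have hbS : branch a b z ∈ S := by
      refine ⟨?_, ?_⟩
      · obtain ⟨z0, z1⟩ := hz.1
        cases b <;> simp only [branch, cond_true, cond_false] <;> constructor <;>
          nlinarith [mul_pos ha z0]
      · rw [H.p_branch b z hz1, H.q_branch b z hz1, hz.2]
    rw [mem_ofPred_eq, ← hℓS hbS, ← hℓS hz]
    exact H.p_branch b z hz1
  obtain ⟨X, K, M', hK, -, hXM, hX⟩ := H2.exists_quadratic ha ha1 hc1 hℓ hℓlip hinv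
  have h01 : ((0 : ℝ) : Torus) = ((1 : ℝ) : Torus) := coe_one_torus.symm
  obtain ⟨hℓ01, hX01⟩ := H2.match_ends ha ha1 hc1 hℓ hℓlip hinv (hf.strictMono _).injective
    (by simp only [h01]) (funext fun y => by rw [fderiv_lift_add_one])
    (funext fun y => by rw [fderiv_lift_add_one]) hX
  have hφrep : ∀ z : Torus, AddCircle.liftIco 1 0 ℓ z = ℓ (rep z) := by
    intro z
    conv_lhs => rw [← coe_rep z]
    exact AddCircle.liftIco_zero_coe_apply (rep_mem z)
  have hφc : Continuous fun θ : Torus2 => AddCircle.liftIco 1 0 ℓ θ.2 :=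
    (AddCircle.liftIco_zero_continuous hℓ01 hℓc.continuousOn).comp continuous_snd
  refine ⟨fun θ => AddCircle.liftIco 1 0 ℓ θ.2, ?_, fun _ _ _ => rfl, ?_⟩
  · refine isC1Lip_of_quadratic (g := fun x => ℓ (Int.fract x)) (X := fun x => X (Int.fract x))
      (M := M') hK (fun ξ x => ?_) (fun x => hXM _ ⟨Int.fract_nonneg x, (Int.fract_lt_one x).le⟩)
      (fun x x' hd => quadratic_periodic hℓ01 hX01 hX hd)
    rw [hφrep, rep_coe_eq_fract]
  · refine closure_graph_eq hB.2.2 hφc ?_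
    rintro ⟨ξ, z⟩ hθ
    rw [hf.mem_pinched, ← coe_rep z] at hθ
    rw [hφrep, hf.phiPlus_eq ξ 0 z]
    conv_rhs => rw [← coe_rep z]
    -- The representative may be `0`, which is not in `S`. Since `p` is continuous at pinched
    -- points, both `ℓ` and `p` are recovered there as limits along `S`.
    have hmem := hScl (Ico_subset_Icc_self (rep_mem z))
    rw [mem_closure_iff_nhdsWithin_neBot] at hmem
    have t1 : Tendsto p (𝓝[S] rep z) (𝓝 (p (rep z))) :=
      (hcont _ hθ).1.tendsto.mono_left nhdsWithin_le_nhds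
    have t2 : Tendsto ℓ (𝓝[S] rep z) (𝓝 (ℓ (rep z))) :=
      (hℓc.tendsto _).mono_left nhdsWithin_le_nhds
    refine tendsto_nhds_unique (t2.congr' ?_) t1
    filter_upwards [self_mem_nhdsWithin] with x hx
    exact (hℓS hx).symm

end BakerSkew

theorem mainTheorem6 (a : ℝ) (f : BakerSkew.Torus → ℝ → ℝ) (s t s' t' : ℝ)
    (hf : BakerSkew.Standing a f s t s' t') (hB : BakerSkew.CaseB a f) :
    (MeasureTheory.volume (BakerSkew.pinched a f) = 0 →
      ∃ φ : BakerSkew.Torus2 → ℝ, BakerSkew.IsC1Lip φ ∧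
        (∀ ξ ξ' x : BakerSkew.Torus, φ (ξ, x) = φ (ξ', x)) ∧
        BakerSkew.pinchedClosure a f = BakerSkew.graphOf φ) ∧
    (Continuous (BakerSkew.phiPlus a f) →
      BakerSkew.graphOf (BakerSkew.phiPlus a f) = BakerSkew.pinchedClosure a f ∧
      ¬ BakerSkew.CaseB1 a f (Set.Icc s t) ∧
      (MeasureTheory.volume (BakerSkew.pinched a f) = 0 →
        BakerSkew.IsC1Lip (BakerSkew.phiPlus a f))) ∧
    (Continuous (BakerSkew.phiMinus a f) →
      BakerSkew.graphOf (BakerSkew.phiMinus a f) = BakerSkew.pinchedClosure a f ∧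
      ¬ BakerSkew.CaseB1 a f (Set.Icc s t) ∧
      (MeasureTheory.volume (BakerSkew.pinched a f) = 0 →
        BakerSkew.IsC1Lip (BakerSkew.phiMinus a f))) := by
  have hA := BakerSkew.exists_isC1Lip hf hB
  refine ⟨hA, fun hc => ?_, fun hc => ?_⟩
  · have hg : BakerSkew.graphOf (BakerSkew.phiPlus a f) = BakerSkew.pinchedClosure a f :=
      (BakerSkew.closure_graph_eq hB.2.2 hc fun _ _ => rfl).symm
    refine ⟨hg, BakerSkew.not_caseB1_of_graph hg, fun h0 => ?_⟩
    obtain ⟨φ, hφ, -, hgφ⟩ := hA h0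
    rwa [BakerSkew.graphOf_injective (hg.trans hgφ)]
  · have hg : BakerSkew.graphOf (BakerSkew.phiMinus a f) = BakerSkew.pinchedClosure a f :=
      (BakerSkew.closure_graph_eq hB.2.2 hc fun _ hθ => Eq.symm hθ).symm
    refine ⟨hg, BakerSkew.not_caseB1_of_graph hg, fun h0 => ?_⟩
    obtain ⟨φ, hφ, -, hgφ⟩ := hA h0
    rwa [BakerSkew.graphOf_injective (hg.trans hgφ)]
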